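/- For a field $\mathbb F$, an algebraic circuit over $\mathbb F$ is a directed acyclic graph whose leaves are labeled by variables or elements of $\mathbb F$ and whose internal nodes are labeled by $+$ or $\times$; its size is its number of wires. For $n\ge 1$ let $N=\binom{2n}{n}$, and identify the variables $c_1,\dots,c_N$, by an arbitrary fixed numbering, with the monomials of total degree at most $n$ in $x_1,\dots,x_n$; thus every $f\in\mathbb F[x_1,\dots,x_n]$ of total degree at most $n$ has a coefficient vector $\mathrm{coeff}(f)\in\mathbb F^N$. Let $s,d,t:\mathbb N\to\mathbb N$ be polynomially bounded. Write $\mathcal D_N$ for the class of polynomials in $\mathbb F[c_1,\dots,c_N]$ of total degree at most $d(N)$ that are computed by circuits of size at most $s(N)$. A set $\mathcal H\subseteq\mathbb F^N$ is a hitting set for $\mathcal D_N$ if every non-zero $D\in\mathcal D_N$ satisfies $D(\alpha)\ne 0$ for some $\alpha\in\mathcal H$. We say that $\mathcal D_N$ has a $t(n)$-succinct hitting set if the (possibly infinite) set of the vectors $\mathrm{coeff}(f)$, over all $f\in\mathbb F[x_1,\dots,x_n]$ of total degree at most $n$ computed by circuits of size at most $t(n)$, is a hitting set for $\mathcal D_N$.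 Corollary. If $\mathcal D_N$ (the $\mathrm{poly}(N)$-size, $\mathrm{poly}(N)$-degree circuits) has a $t(n)$-succinct (that is, $\mathrm{poly}(n)$-succinct) hitting set, then it has an explicit hitting set of size $\mathrm{poly}(N)^{\mathrm{polylog}(N)}$. Precisely: there are a program $P$ and a constant $c$, depending only on $s,d,t$, such that for every field $\mathbb F$, every enumeration $e$ of elements of $\mathbb F$, every $n\ge1$ and every numbering of the monomials for which $\mathcal D_N$ has a $t(n)$-succinct hitting set, the program $P$ on input $n$ halts within $N^{c\lfloor\log_2 N\rfloor^c}$ steps and prints a list of at most $N^{c\lfloor\log_2 N\rfloor^c}$ points of $\mathbb F^N$ that form a hitting set for $\mathcal D_N$. Here programs are those of a random access machine which, at unit cost, adds and subtracts natural numbers, adds, subtracts and multiplies field elements, addresses its memory indirectly, tests a natural number for zero, prints a field element, and accesses $e(k)$ for a computed $k$; programs contain no elements of $\mathbb F$. An enumeration is a map $e:\mathbb N\to\mathbb F$ such that all $e(k)$ are distinct if $\mathbb F$ is infinite, and $e(0),\dots,e(q-1)$ are distinct if $|\mathbb F|=q<\infty$. -/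

import Mathlib

namespace AlgComp

/-! ### Algebraic circuits -/

/-- The label of a node of an algebraic circuit, together with its incoming wires.  Leaves carry a
variable or a field element; internal nodes are sums or products of arbitrary fan-in.  A node may
be wired twice to the same node (as in `x * x`), so the incoming wires form a list.  (An operation
node with no incoming wire computes the constant `0` or `1`, just as a constant leaf does.) -/
inductive Gate (F σ ν : Type*) where
  | var (i : σ)
  | const (a : F)
  | add (args : List ν)
  | mul (args : List ν)

/-- The sources of the incoming wires. -/
def Gate.args {F σ ν : Type*} : Gate F σ ν → List ν
  | .var _ => []
  | .const _ => []
  | .add l => l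
  | .mul l => l

/-- The polynomial computed at a node from the polynomials computed at the other nodes. -/
noncomputable def Gate.eval {F σ ν : Type*} [CommSemiring F] (val : ν → MvPolynomial σ F) :
    Gate F σ ν → MvPolynomial σ F
  | .var i => MvPolynomial.X i
  | .const a => MvPolynomial.C a
  | .add l => (l.map val).sum
  | .mul l => (l.map val).prod

/-- An algebraic circuit over `F` in the variables `σ`: a finite directed acyclic graph, whose nodes
are listed in a topological order, with a designated output node. -/
structure Circuit (F σ : Type*) where
  nodes : ℕ
  gate : Fin nodes → Gate F σ (Fin nodes)
  acyclic : ∀ v, ∀ w ∈ (gate v).args, w < v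
  output : Fin nodes

/-- The size of a circuit is its number of wires. -/
def Circuit.size {F σ : Type*} (C : Circuit F σ) : ℕ :=
  ∑ v, (C.gate v).args.length

/-- The polynomial computed at a node.  (The default value `0` is never used, see
`Circuit.val_eq`.) -/
noncomputable def Circuit.val {F σ : Type*} [CommSemiring F] (C : Circuit F σ)
    (v : Fin C.nodes) : MvPolynomial σ F :=
  (C.gate v).eval fun w => if _h : w < v then C.val w else 0
termination_by v

theorem Circuit.val_eq {F σ : Type*} [CommSemiring F] (C : Circuit F σ) (v : Fin C.nodes) :
    C.val v = (C.gate v).eval C.val := by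
  rw [Circuit.val]
  have h := C.acyclic v
  cases hg : C.gate v with
  | var i => rfl
  | const a => rfl
  | add l =>
    simp only [hg, Gate.args] at h
    simp only [Gate.eval]
    congr 1
    exact List.map_congr_left fun w hw => by simp [h w hw]
  | mul l =>
    simp only [hg, Gate.args] at h
    simp only [Gate.eval]
    congr 1
    exact List.map_congr_left fun w hw => by simp [h w hw]

/-- The polynomial computed by a circuit. -/
noncomputable def Circuit.poly {F σ : Type*} [CommSemiring F] (C : Circuit F σ) :
    MvPolynomial σ F :=
  C.val C.output

/-- The polynomials over `F` in the variables `σ` of total degree at most `d` that are computed by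
an algebraic circuit of size at most `s`. -/
def circuitClass (F σ : Type*) [Field F] (s d : ℕ) : Set (MvPolynomial σ F) :=
  {f | f.totalDegree ≤ d ∧ ∃ C : Circuit F σ, C.size ≤ s ∧ C.poly = f}

/-! ### Hitting sets -/

/-- `H` is a hitting set for the class `𝒟`: every non-zero `D ∈ 𝒟` is non-zero at a point of
`H`. -/
def IsHittingSet {F σ : Type*} [Field F] (H : Set (σ → F)) (𝒟 : Set (MvPolynomial σ F)) : Prop :=
  ∀ D ∈ 𝒟, D ≠ 0 → ∃ α ∈ H, MvPolynomial.eval α D ≠ 0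

/-- The (exponent vectors of) monomials of total degree at most `d` in `n` variables. -/
abbrev Monomials (n d : ℕ) : Type := {a : Fin n →₀ ℕ // a.degree ≤ d}

/-- The vector of coefficients of an `n`-variate polynomial at the monomials of degree at most `d`,
these being numbered by `φ`. -/
def coeffVec {F : Type*} [Field F] {n d N : ℕ} (φ : Monomials n d ≃ Fin N)
    (f : MvPolynomial (Fin n) F) : Fin N → F :=
  fun i => f.coeff (φ.symm i).1

/-- There is an `s`-succinct hitting set for `𝒟`: the coefficient vectors of the `n`-variate
polynomials of degree at most `d` computed by circuits of size at most `s` hit `𝒟`. -/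
def HasSuccinctHittingSet {F : Type*} [Field F] {n d N : ℕ} (φ : Monomials n d ≃ Fin N) (s : ℕ)
    (𝒟 : Set (MvPolynomial (Fin N) F)) : Prop :=
  IsHittingSet (coeffVec φ '' circuitClass F (Fin n) s d) 𝒟

/-- The number of monomials of degree at most `d` in `n` variables is `binom (n + d) d`, so that
numberings as above exist. -/
theorem nonempty_monomials_equiv (n d : ℕ) :
    Nonempty (Monomials n d ≃ Fin ((n + d).choose d)) := by
  have key : ∀ P : Fin (n + 1) →₀ ℕ, (P.sum fun _ => id) = P 0 + P.tail.degree := fun P => by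
    simp [Finsupp.sum_fintype, Finsupp.degree_eq_sum, Fin.sum_univ_succ, Finsupp.tail_apply]
  let E : Monomials n d ≃ {P : Fin (n + 1) →₀ ℕ // (P.sum fun _ => id) = d} :=
    { toFun := fun a => ⟨Finsupp.cons (d - a.1.degree) a.1, by
        have := a.2
        rw [key, Finsupp.cons_zero, Finsupp.tail_cons]
        omega⟩
      invFun := fun P => ⟨Finsupp.tail P.1, by
        have h := P.2
        rw [key] at h
        omega⟩
      left_inv := fun a => by simp
      right_inv := fun P => by
        have h := P.2
        rw [key] at h
        apply Subtype.ext
        have h0 : d - P.1.tail.degree = P.1 0 := by omega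
        change Finsupp.cons (d - P.1.tail.degree) P.1.tail = P.1
        rw [h0, Finsupp.cons_tail] }
  refine ⟨(E.trans (Sym.equivNatSum (Fin (n + 1)) d).symm).trans (Fintype.equivFinOfCardEq ?_)⟩
  rw [Sym.card_sym_eq_choose, Fintype.card_fin, show n + 1 + d - 1 = n + d by omega]

/-! ### Growth -/

/-- `f m = poly(m)`. -/
def PolyBounded (f : ℕ → ℕ) : Prop :=
  ∃ k : ℕ, ∀ m, f m ≤ m ^ k + k

/-- The quasipolynomial `N ^ (c * (log N) ^ c)`. -/
def quasiPoly (c N : ℕ) : ℕ :=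
  N ^ (c * Nat.log 2 N ^ c)

/-! ### Explicitness: random access machines over a field

A machine has a memory of natural numbers and a memory of field elements.  It adds and subtracts
natural numbers (with no multiplication of natural numbers, numbers stay of length linear in the
running time), uses them as addresses, performs ring operations on field elements, accesses the
elements of a given enumeration of elements of the field, and prints field elements.  Each
assignment, each test and each printing costs one step.  Programs contain no field elements, so that
a program is a finite object which makes sense over every field. -/

/-- Expressions for natural numbers; `mem a` is the content of the cell with address `a`. -/
inductive NExp where
  | lit (k : ℕ)
  | mem (a : NExp)
  | add (a b : NExp)
  | sub (a b : NExp)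

/-- Expressions for field elements; `mem a` is the content of the cell with address `a`, and
`elt a` is the `a`-th element of the enumeration. -/
inductive FExp where
  | zero
  | one
  | mem (a : NExp)
  | elt (a : NExp)
  | add (x y : FExp)
  | sub (x y : FExp)
  | mul (x y : FExp)

/-- Programs. -/
inductive Prog where
  | skip
  | setN (a v : NExp)
  | setF (a : NExp) (v : FExp)
  | print (v : FExp)
  | seq (p q : Prog)
  | ite (c : NExp) (p q : Prog)
  | while (c : NExp) (p : Prog)

/-- The state of a machine: its two memories and the field elements printed so far. -/
structure State (F : Type*) where
  nat : ℕ → ℕ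
  fld : ℕ → F
  out : List F

/-- The value of an expression for natural numbers (subtraction is truncated). -/
def NExp.eval (m : ℕ → ℕ) : NExp → ℕ
  | .lit k => k
  | .mem a => m (a.eval m)
  | .add a b => a.eval m + b.eval m
  | .sub a b => a.eval m - b.eval m

/-- The value of an expression for field elements, relative to the enumeration `e`. -/
def FExp.eval {F : Type*} [Field F] (e : ℕ → F) (S : State F) : FExp → F
  | .zero => 0
  | .one => 1
  | .mem a => S.fld (a.eval S.nat)
  | .elt a => e (a.eval S.nat)
  | .add x y => x.eval e S + y.eval e S
  | .sub x y => x.eval e S - y.eval e S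
  | .mul x y => x.eval e S * y.eval e S

/-- `Runs e p S T S'`: started in the state `S`, the program `p` halts after exactly `T` steps in
the state `S'`.  A test succeeds when the tested number is not zero. -/
inductive Runs {F : Type*} [Field F] (e : ℕ → F) : Prog → State F → ℕ → State F → Prop
  | skip (S : State F) : Runs e .skip S 1 S
  | setN (a v : NExp) (S : State F) :
      Runs e (.setN a v) S 1 { S with nat := Function.update S.nat (a.eval S.nat) (v.eval S.nat) }
  | setF (a : NExp) (v : FExp) (S : State F) :
      Runs e (.setF a v) S 1 { S with fld := Function.update S.fld (a.eval S.nat) (v.eval e S) }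
  | print (v : FExp) (S : State F) :
      Runs e (.print v) S 1 { S with out := S.out ++ [v.eval e S] }
  | seq {p q : Prog} {S₁ S₂ S₃ : State F} {T₁ T₂ : ℕ} :
      Runs e p S₁ T₁ S₂ → Runs e q S₂ T₂ S₃ → Runs e (.seq p q) S₁ (T₁ + T₂) S₃
  | ite_true {c : NExp} {p q : Prog} {S S' : State F} {T : ℕ} :
      c.eval S.nat ≠ 0 → Runs e p S T S' → Runs e (.ite c p q) S (T + 1) S'
  | ite_false {c : NExp} {p q : Prog} {S S' : State F} {T : ℕ} :
      c.eval S.nat = 0 → Runs e q S T S' → Runs e (.ite c p q) S (T + 1) S'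
  | while_true {c : NExp} {p : Prog} {S₁ S₂ S₃ : State F} {T₁ T₂ : ℕ} :
      c.eval S₁.nat ≠ 0 → Runs e p S₁ T₁ S₂ → Runs e (.while c p) S₂ T₂ S₃ →
      Runs e (.while c p) S₁ (T₁ + T₂ + 1) S₃
  | while_false {c : NExp} {p : Prog} {S : State F} :
      c.eval S.nat = 0 → Runs e (.while c p) S 1 S

/-- The initial state on input `n`: cell `0` holds `n`, all other cells hold `0`. -/
def State.init (F : Type*) [Field F] (n : ℕ) : State F where
  nat := fun i => if i = 0 then n else 0
  fld := fun _ => 0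
  out := []

/-- On input `n`, the program `P` halts within `T` steps, having printed the points of the list `H`
one after the other, coordinate by coordinate. -/
def PrintsWithin {F : Type*} [Field F] (e : ℕ → F) (P : Prog) (n T : ℕ) {N : ℕ}
    (H : List (Fin N → F)) : Prop :=
  ∃ T' ≤ T, ∃ S : State F, Runs e P (State.init F n) T' S ∧ S.out = H.flatMap List.ofFn

/-- `e` lists elements of `F` without repetition: all the `e k` are distinct if `F` is infinite, and
the first `q` of them are distinct if `F` has `q` elements (later ones are arbitrary). -/
def IsEnumeration {F : Type*} (e : ℕ → F) : Prop :=
  Set.InjOn e {k : ℕ | (k : ℕ∞) < ENat.card F}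

end AlgComp

open AlgComp

namespace AlgComp

/-! ### A universal family of univariate straight-line programs -/

/-! The substitution of `X ^ 2 ^ (n * j)` for `x_j` sends distinct monomials of degree at most `n`
to distinct powers of `X` with exponents below `2 ^ (n * n)`. So the coefficient vector of `f` can
be read off from a univariate polynomial.

The images of all circuits of size `t` under this substitution are specializations of a single
object, the universal program `u_0 = 1`, `u_1 = X`, `u_k = ∑ y_{k,j,l} u_j u_l`. It spends one
instruction on each power `X ^ 2 ^ j` and one on each wire into a product gate, while linear
combinations cost nothing. Hence `n * n + t + 3 ≤ K` results suffice
(`exists_universal_eq_circuit`). They use at most `K ^ 3` parameters, and the coefficients of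
`u_{K-1}` are polynomials in them of degree less than `2 ^ K` (`totalDegree_coeff_universal`).

For a non-zero `D` in the class, let `Q(y)` be the value of `D` at the coefficients of `u_{K-1}`.
The succinct hitting set provides parameters with `Q(y) ≠ 0`, and `deg Q ≤ d * 2 ^ K < L = 2 ^ (2 *
K)`. So `Q` is non-zero somewhere on the grid of the first `L` field elements
(`exists_eval_digits_ne_zero`), and the coefficient vectors of `u_{K-1}` at all grid points form a
hitting set (`gridPoint_hits`); these need not be coefficient vectors of small circuits. With `V = 2
^ (2 * K ^ 4)` the grid has at most `V` points. Since `K = (n + a) ^ a` and `n ≤ log N`, this is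
quasipolynomial in `N`.

The machine reads the parameters as the base-`L` digits of a counter `v < V` and runs the universal
program modulo `X ^ 2 ^ (n * n)`. Every number governing a loop is at most `V`, so even unary
arithmetic keeps the time below `V ^ 40`. -/

/-- The position of the first parameter of the `k`-th instruction. -/
def paramOffset (k : ℕ) : ℕ := ∑ i ∈ Finset.Ico 2 k, i ^ 2

theorem paramOffset_succ {k : ℕ} (hk : 2 ≤ k) : paramOffset (k + 1) = paramOffset k + k ^ 2 :=
  Finset.sum_Ico_succ_top hk _

theorem paramOffset_mono : Monotone paramOffset := fun _ _ h =>
  Finset.sum_le_sum_of_subset (Finset.Ico_subset_Ico_right h)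

theorem paramOffset_le (k : ℕ) : paramOffset k ≤ k ^ 3 := by
  calc paramOffset k ≤ ∑ _i ∈ Finset.Ico 2 k, k ^ 2 := Finset.sum_le_sum fun i hi =>
        Nat.pow_le_pow_left (Finset.mem_Ico.1 hi).2.le 2
    _ = (k - 2) * k ^ 2 := by rw [Finset.sum_const, Nat.card_Ico, smul_eq_mul]
    _ ≤ k * k ^ 2 := Nat.mul_le_mul_right _ (Nat.sub_le k 2)
    _ = k ^ 3 := by ring

theorem param_lt {k j l : ℕ} (hk : 2 ≤ k) (hj : j < k) (hl : l < k) :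
    paramOffset k + j * k + l < paramOffset (k + 1) := by
  rw [paramOffset_succ hk, add_assoc]
  have : (j + 1) * k ≤ k * k := Nat.mul_le_mul_right _ hj
  nlinarith

/-- The universal straight-line program: it starts with `1` and `X`, and every further instruction
computes a bilinear combination of the preceding results, with coefficients `y`. -/
noncomputable def universal {A : Type*} [CommRing A] (y : ℕ → A) : ℕ → Polynomial A
  | 0 => 1
  | 1 => Polynomial.X
  | k + 2 => ∑ j : Fin (k + 2), ∑ l : Fin (k + 2),
      Polynomial.C (y (paramOffset (k + 2) + j * (k + 2) + l)) * (universal y j * universal y l)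
termination_by k => k
decreasing_by
  · exact j.2
  · exact l.2

section Universal

variable {A : Type*} [CommRing A]

theorem universal_zero (y : ℕ → A) : universal y 0 = 1 := by rw [universal]

theorem universal_one (y : ℕ → A) : universal y 1 = Polynomial.X := by rw [universal]

theorem universal_eq (y : ℕ → A) {k : ℕ} (hk : 2 ≤ k) :
    universal y k = ∑ j ∈ Finset.range k, ∑ l ∈ Finset.range k,
      Polynomial.C (y (paramOffset k + j * k + l)) * (universal y j * universal y l) := by
  obtain ⟨k, rfl⟩ := Nat.exists_eq_add_of_le' hk
  rw [universal, Finset.sum_range]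
  exact Finset.sum_congr rfl fun j _ => (Finset.sum_range fun l =>
    Polynomial.C (y (paramOffset (k + 2) + j * (k + 2) + l)) * (universal y j * universal y l)).symm

/-- The parameters of later instructions are not read, so they can still be chosen freely. -/
theorem universal_congr {y y' : ℕ → A} (k : ℕ) (h : ∀ x < paramOffset (k + 1), y x = y' x) :
    universal y k = universal y' k := by
  induction k using Nat.strong_induction_on with
  | _ k ih =>
    rcases Nat.lt_or_ge k 2 with hk | hk
    · interval_cases k
      · rw [universal_zero, universal_zero]
      · rw [universal_one, universal_one]
    · rw [universal_eq y hk, universal_eq y' hk]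
      refine Finset.sum_congr rfl fun j hj => Finset.sum_congr rfl fun l hl => ?_
      rw [Finset.mem_range] at hj hl
      have aux : ∀ i < k, universal y i = universal y' i := fun i hi =>
        ih i hi fun x hx => h x (hx.trans_le (paramOffset_mono (by omega)))
      rw [aux j hj, aux l hl, h _ (param_lt hk hj hl)]

/-- This is used to pass from indeterminate parameters to their values. -/
theorem universal_map {B : Type*} [CommRing B] (f : A →+* B) (y : ℕ → A) (k : ℕ) :
    (universal y k).map f = universal (fun x => f (y x)) k := by
  induction k using Nat.strong_induction_on with
  | _ k ih =>
    rcases Nat.lt_or_ge k 2 with hk | hk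
    · interval_cases k
      · simp [universal_zero]
      · simp [universal_one]
    · rw [universal_eq y hk, universal_eq _ hk, Polynomial.map_sum]
      refine Finset.sum_congr rfl fun j hj => ?_
      rw [Polynomial.map_sum]
      refine Finset.sum_congr rfl fun l hl => ?_
      rw [Finset.mem_range] at hj hl
      rw [Polynomial.map_mul, Polynomial.map_mul, ih j hj, ih l hl, Polynomial.map_C]

/-- The degree of the universal program in its parameters. -/
theorem totalDegree_coeff_universal {σ : Type*} (y : ℕ → MvPolynomial σ A)
    (hy : ∀ x, (y x).totalDegree ≤ 1) (k i : ℕ) :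
    ((universal y k).coeff i).totalDegree ≤ 2 ^ k - 1 := by
  induction k using Nat.strong_induction_on generalizing i with
  | _ k ih =>
    rcases Nat.lt_or_ge k 2 with hk | hk
    · interval_cases k
      · rw [universal_zero, Polynomial.coeff_one]; split_ifs <;> simp
      · rw [universal_one, Polynomial.coeff_X]; split_ifs <;> simp
    · rw [universal_eq y hk, Polynomial.finsetSum_coeff]
      refine MvPolynomial.totalDegree_finsetSum_le fun j hj => ?_
      rw [Polynomial.finsetSum_coeff]
      refine MvPolynomial.totalDegree_finsetSum_le fun l hl => ?_
      rw [Finset.mem_range] at hj hl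
      rw [Polynomial.coeff_C_mul, Polynomial.coeff_mul]
      refine (MvPolynomial.totalDegree_mul _ _).trans ?_
      -- The bound solves `δ_k = 2 * δ_{k-1} + 1`: two earlier factors and one parameter.
      have key : ∀ i, ∀ m < k, ((universal y m).coeff i).totalDegree ≤ 2 ^ (k - 1) - 1 :=
        fun i m hm => (ih m hm i).trans
          (Nat.sub_le_sub_right (Nat.pow_le_pow_right (by norm_num) (by omega)) 1)
      have hs : (∑ x ∈ Finset.HasAntidiagonal.antidiagonal i,
          (universal y j).coeff x.1 * (universal y l).coeff x.2).totalDegree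
          ≤ (2 ^ (k - 1) - 1) + (2 ^ (k - 1) - 1) :=
        MvPolynomial.totalDegree_finsetSum_le fun x _ =>
          (MvPolynomial.totalDegree_mul _ _).trans (Nat.add_le_add (key _ _ hj) (key _ _ hl))
      have h2 : 2 ^ k = 2 ^ (k - 1) + 2 ^ (k - 1) := by
        rw [← two_mul, ← pow_succ', Nat.sub_add_cancel (by omega)]
      have := hy (paramOffset k + j * k + l)
      have := Nat.one_le_two_pow (n := k - 1)
      omega

end Universal

/-! ### Small circuits as specializations of the universal program -/

section Generation

open scoped Pointwise

variable {F : Type*} [Field F]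

/-- The linear span of the first `k` results of the universal program. -/
noncomputable def universalSpan (y : ℕ → F) (k : ℕ) : Submodule F (Polynomial F) :=
  Submodule.span F (Set.range fun j : Fin k => universal y j)

/-- For some choice of the parameters, all elements of `S` are linear combinations of the first `k`
results of the universal program. -/
def Generates (k : ℕ) (S : Set (Polynomial F)) : Prop :=
  ∃ y : ℕ → F, S ⊆ universalSpan y k

theorem universalSpan_mono (y : ℕ → F) {k k' : ℕ} (h : k ≤ k') :
    universalSpan y k ≤ universalSpan y k' := by
  refine Submodule.span_mono ?_
  rintro _ ⟨j, rfl⟩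
  exact ⟨Fin.castLE h j, rfl⟩

theorem universal_mem_span (y : ℕ → F) {j k : ℕ} (h : j < k) :
    universal y j ∈ universalSpan y k :=
  Submodule.subset_span ⟨⟨j, h⟩, rfl⟩

theorem Generates.mono {k k' : ℕ} {S S' : Set (Polynomial F)} (h : Generates k S) (hk : k ≤ k')
    (hS : ∀ p ∈ S', p ∈ Submodule.span F S) : Generates k' S' := by
  obtain ⟨y, hy⟩ := h
  exact ⟨y, fun p hp => universalSpan_mono y hk (Submodule.span_le.2 hy (hS p hp))⟩

/-- An element of the product of the spans is a bilinear combination of earlier results. Its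
coefficients can be taken as the parameters of instruction `k`, which no earlier instruction reads.
-/
theorem exists_universal_eq (y : ℕ → F) {k : ℕ} (hk : 2 ≤ k) {p : Polynomial F}
    (hp : p ∈ universalSpan y k * universalSpan y k) :
    ∃ y' : ℕ → F, universalSpan y' k = universalSpan y k ∧ universal y' k = p := by
  rw [universalSpan, Submodule.span_mul_span] at hp
  have hr : (Set.range fun j : Fin k => universal y j) * (Set.range fun j : Fin k => universal y j)
      = Set.range fun x : Fin k × Fin k => universal y x.1 * universal y x.2 := by
    ext q
    simp [Set.mem_mul]
  rw [hr, Submodule.mem_span_range_iff_exists_fun] at hp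
  obtain ⟨c, rfl⟩ := hp
  have hk0 : 0 < k := by omega
  -- Beyond the old parameters, the position is decoded into the pair `(j, l)` by division by `k`;
  -- the outer `% k` only serves to land in `Fin k`.
  let y' : ℕ → F := fun x => if x < paramOffset k then y x else
    c (⟨(x - paramOffset k) / k % k, Nat.mod_lt _ hk0⟩, ⟨(x - paramOffset k) % k, Nat.mod_lt _ hk0⟩)
  have hold : ∀ j < k, universal y' j = universal y j := fun j hj =>
    universal_congr j fun x hx => if_pos (hx.trans_le (paramOffset_mono hj))
  have hnew : ∀ j l : Fin k, y' (paramOffset k + j * k + l) = c (j, l) := by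
    intro j l
    have h1 : paramOffset k + j * k + l - paramOffset k = l + k * j := by
      rw [Nat.mul_comm k]; omega
    have h2 : ¬ paramOffset k + j * k + l < paramOffset k := by omega
    simp only [y', if_neg h2]
    congr 2
    · apply Fin.ext
      simp only [h1, Nat.add_mul_div_left _ _ hk0, Nat.div_eq_of_lt l.2, Nat.zero_add,
        Nat.mod_eq_of_lt j.2]
    · apply Fin.ext
      simp only [h1, Nat.add_mul_mod_self_left, Nat.mod_eq_of_lt l.2]
  refine ⟨y', ?_, ?_⟩
  · rw [universalSpan, universalSpan]
    congr 2
    funext j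
    exact hold j j.2
  · rw [universal_eq y' hk, Finset.sum_range, Fintype.sum_prod_type]
    refine Finset.sum_congr rfl fun j _ => ?_
    rw [Finset.sum_range]
    refine Finset.sum_congr rfl fun l _ => ?_
    rw [hold j j.2, hold l l.2, hnew, Polynomial.smul_eq_C_mul]

/-- Multiplying two linear combinations takes one instruction; forming them takes none. -/
theorem Generates.mul {k : ℕ} (hk : 2 ≤ k) {S : Set (Polynomial F)} (h : Generates k S)
    {p q : Polynomial F} (hp : p ∈ Submodule.span F S) (hq : q ∈ Submodule.span F S) :
    Generates (k + 1) (insert (p * q) S) := by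
  obtain ⟨y, hy⟩ := h
  have hS := Submodule.span_le.2 hy
  obtain ⟨y', h1, h2⟩ := exists_universal_eq y hk (Submodule.mul_mem_mul (hS hp) (hS hq))
  refine ⟨y', Set.insert_subset ?_ ?_⟩
  · rw [← h2]
    exact universal_mem_span y' k.lt_succ_self
  · exact fun q hq => universalSpan_mono y' k.le_succ (h1 ▸ hy hq)

theorem Generates.list_prod {k : ℕ} (hk : 2 ≤ k) {S : Set (Polynomial F)} (h : Generates k S)
    (h1 : 1 ∈ S) (l : List (Polynomial F)) (hl : ∀ p ∈ l, p ∈ Submodule.span F S) :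
    Generates (k + l.length) (insert l.prod S) := by
  induction l with
  | nil =>
    refine h.mono le_rfl fun p hp => Submodule.subset_span ?_
    rcases hp with rfl | hp
    exacts [by simpa using h1, hp]
  | cons p l ih =>
    have h' := ih fun q hq => hl q (List.mem_cons_of_mem _ hq)
    have hsub : S ⊆ insert l.prod S := Set.subset_insert _ _
    have h'' := h'.mul (by omega) (Submodule.span_mono hsub (hl p List.mem_cons_self))
      (Submodule.subset_span (Set.mem_insert l.prod S))
    rw [List.prod_cons, List.length_cons, ← add_assoc]
    refine h''.mono le_rfl fun q hq => Submodule.subset_span ?_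
    rcases hq with rfl | hq
    exacts [Set.mem_insert _ _, Or.inr (Or.inr hq)]

/-- Repeated squaring: each further power costs one instruction. -/
theorem generates_powers (m : ℕ) :
    Generates (m + 2) (insert 1 {p : Polynomial F | ∃ j ≤ m, p = Polynomial.X ^ 2 ^ j}) := by
  induction m with
  | zero =>
    refine ⟨0, Set.insert_subset ?_ ?_⟩
    · rw [← universal_zero (0 : ℕ → F)]
      exact universal_mem_span _ (by norm_num)
    · rintro _ ⟨j, hj, rfl⟩
      obtain rfl : j = 0 := by omega
      rw [pow_zero, pow_one, ← universal_one (0 : ℕ → F)]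
      exact universal_mem_span _ (by norm_num)
  | succ m ih =>
    have hm : (Polynomial.X ^ 2 ^ m : Polynomial F) ∈ Submodule.span F
        (insert 1 {p : Polynomial F | ∃ j ≤ m, p = Polynomial.X ^ 2 ^ j}) :=
      Submodule.subset_span (Or.inr ⟨m, le_rfl, rfl⟩)
    have h := ih.mul (by omega) hm hm
    refine h.mono (by omega) fun p hp => Submodule.subset_span ?_
    rcases hp with rfl | ⟨j, hj, rfl⟩
    · exact Or.inr (Or.inl rfl)
    · rcases Nat.lt_or_ge m j with h' | h'
      · left
        obtain rfl : j = m + 1 := by omega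
        rw [← pow_add, pow_succ, mul_two]
      · exact Or.inr (Or.inr ⟨j, h', rfl⟩)

/-- Induction along the topological order. A product gate costs one instruction per incoming wire;
the other nodes lie in the span of what is already there, constants being multiples of `1`. The
field elements of the circuit are thus absorbed into the parameters. -/
theorem Generates.circuit_nodes {σ : Type*} {k : ℕ} (hk : 2 ≤ k) {S : Set (Polynomial F)}
    (h : Generates k S) (h1 : 1 ∈ S) (θ : MvPolynomial σ F →ₐ[F] Polynomial F)
    (hθ : ∀ i, θ (MvPolynomial.X i) ∈ S) (C : Circuit F σ) (m : ℕ) (hm : m ≤ C.nodes) :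
    Generates (k + ∑ v : Fin C.nodes with v.1 < m, (C.gate v).args.length)
      (S ∪ {p | ∃ v : Fin C.nodes, v.1 < m ∧ p = θ (C.val v)}) := by
  induction m with
  | zero =>
    refine h.mono (by omega) fun p hp => Submodule.subset_span ?_
    simpa using hp
  | succ m ih =>
    have ih := ih (by omega)
    set T := S ∪ {p | ∃ v : Fin C.nodes, v.1 < m ∧ p = θ (C.val v)} with hT
    let v : Fin C.nodes := ⟨m, hm⟩
    have hsum : ∑ w : Fin C.nodes with w.1 < m + 1, (C.gate w).args.length
        = (∑ w : Fin C.nodes with w.1 < m, (C.gate w).args.length) + (C.gate v).args.length := by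
      have : (Finset.univ.filter fun w : Fin C.nodes => w.1 < m + 1)
          = insert v (Finset.univ.filter fun w : Fin C.nodes => w.1 < m) := by
        ext w
        simp only [Finset.mem_filter, Finset.mem_univ, true_and, Finset.mem_insert, v, Fin.ext_iff]
        omega
      rw [this, Finset.sum_insert (by simp [v]), add_comm]
    have hargs : ∀ w ∈ (C.gate v).args, θ (C.val w) ∈ T := fun w hw =>
      Or.inr ⟨w, C.acyclic v w hw, rfl⟩
    have hST : S ⊆ T := Set.subset_union_left
    suffices hG : Generates (k + (∑ w : Fin C.nodes with w.1 < m, (C.gate w).args.length)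
        + (C.gate v).args.length) (insert (θ (C.val v)) T) by
      rw [hsum, ← add_assoc]
      refine hG.mono le_rfl fun p hp => Submodule.subset_span ?_
      rcases hp with hp | ⟨w, hw, rfl⟩
      · exact Or.inr (Or.inl hp)
      · rcases Nat.lt_or_ge w.1 m with hw' | hw'
        · exact Or.inr (Or.inr ⟨w, hw', rfl⟩)
        · left
          rw [show w = v from Fin.ext (by simp only [v]; omega)]
    -- Leaves and sums need no new instruction.
    have hlin : θ (C.val v) ∈ Submodule.span F T →
        Generates (k + (∑ w : Fin C.nodes with w.1 < m, (C.gate w).args.length)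
          + (C.gate v).args.length) (insert (θ (C.val v)) T) := fun hv =>
      ih.mono (by omega) fun p hp => by
        rcases hp with rfl | hp
        exacts [hv, Submodule.subset_span hp]
    have hval := C.val_eq v
    cases hg : C.gate v with
    | var i =>
      rw [← hg]
      apply hlin
      rw [hval, hg, Gate.eval]
      exact Submodule.subset_span (hST (hθ i))
    | const a =>
      rw [← hg]
      apply hlin
      rw [hval, hg, Gate.eval, MvPolynomial.C_eq_smul_one, map_smul, map_one]
      exact Submodule.smul_mem _ _ (Submodule.subset_span (hST h1))
    | add l =>
      rw [← hg]
      apply hlin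
      rw [hval, hg, Gate.eval, map_list_sum]
      refine list_sum_mem fun p hp => ?_
      rw [List.map_map, List.mem_map] at hp
      obtain ⟨w, hw, rfl⟩ := hp
      exact Submodule.subset_span (hargs w (by rw [hg]; exact hw))
    | mul l =>
      have h' := ih.list_prod (by omega) (hST h1) (l.map fun w => θ (C.val w)) fun p hp => by
        obtain ⟨w, hw, rfl⟩ := List.mem_map.1 hp
        exact Submodule.subset_span (hargs w (by rw [hg]; exact hw))
      rw [hval, hg, Gate.eval, map_list_prod, List.map_map]
      rw [List.length_map] at h'
      exact h'

/-- The universal program computes every small circuit in the variables `X ^ 2 ^ j`. -/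
theorem exists_universal_eq_circuit {σ : Type*} (g : σ → ℕ) {m k : ℕ} (hg : ∀ i, g i ≤ m)
    (C : Circuit F σ) (hk : m + 2 + C.size ≤ k) :
    ∃ y : ℕ → F, universal y k =
      MvPolynomial.aeval (fun i => (Polynomial.X : Polynomial F) ^ 2 ^ g i) C.poly := by
  set θ := MvPolynomial.aeval (R := F) (fun i => (Polynomial.X : Polynomial F) ^ 2 ^ g i) with hθ
  obtain ⟨y, hy⟩ := (generates_powers (F := F) m).circuit_nodes (by omega) (Or.inl rfl) θ
    (fun i => Or.inr ⟨g i, hg i, by rw [hθ, MvPolynomial.aeval_X]⟩) C C.nodes le_rfl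
  have hsum : ∑ v : Fin C.nodes with v.1 < C.nodes, (C.gate v).args.length = C.size := by
    rw [Circuit.size, Finset.filter_true_of_mem fun v _ => v.2]
  rw [hsum] at hy
  have hmem := universalSpan_mono y hk (hy (Or.inr ⟨C.output, C.output.2, rfl⟩))
  have hone := universalSpan_mono y hk (hy (Or.inl (Or.inl rfl)))
  -- So far the output is only in the span of the first `k` results; its product with `1` makes it
  -- the result with index `k`.
  obtain ⟨y', -, h⟩ := exists_universal_eq y (k := k) (by omega)
    (Submodule.mul_mem_mul hmem hone)
  exact ⟨y', by rw [h, mul_one, Circuit.poly]⟩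

end Generation

/-! ### Renaming the variables of a circuit -/

section Rename

variable {F σ τ : Type*}

/-- Rename the variables at the leaves. -/
def Gate.rename {ν : Type*} (f : σ → τ) : Gate F σ ν → Gate F τ ν
  | .var i => .var (f i)
  | .const a => .const a
  | .add l => .add l
  | .mul l => .mul l

theorem Gate.args_rename {ν : Type*} (f : σ → τ) (g : Gate F σ ν) :
    (g.rename f).args = g.args := by
  cases g <;> rfl

/-- Rename the variables of a circuit. -/
def Circuit.rename (f : σ → τ) (C : Circuit F σ) : Circuit F τ where
  nodes := C.nodes
  gate v := (C.gate v).rename f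
  acyclic v w hw := C.acyclic v w (by rwa [Gate.args_rename] at hw)
  output := C.output

theorem Circuit.size_rename (f : σ → τ) (C : Circuit F σ) : (C.rename f).size = C.size :=
  Finset.sum_congr rfl fun v _ => by rw [← Gate.args_rename f (C.gate v)]; rfl

theorem Circuit.val_rename [CommSemiring F] (f : σ → τ) (C : Circuit F σ) (v : Fin C.nodes) :
    (C.rename f).val v = MvPolynomial.rename f (C.val v) := by
  induction v using WellFoundedLT.induction with
  | _ v ih =>
    have h1 := (C.rename f).val_eq v
    have h2 := C.val_eq v
    have hg' : (C.rename f).gate v = (C.gate v).rename f := rfl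
    have hargs := C.acyclic v
    rw [h1, h2, hg']
    cases hg : C.gate v with
    | var i => simp [Gate.rename, Gate.eval]
    | const a => simp [Gate.rename, Gate.eval]
    | add l =>
      simp only [Gate.rename, Gate.eval, map_list_sum, List.map_map]
      congr 1
      exact List.map_congr_left fun w hw => ih w (hargs w (by rw [hg]; exact hw))
    | mul l =>
      simp only [Gate.rename, Gate.eval, map_list_prod, List.map_map]
      congr 1
      exact List.map_congr_left fun w hw => ih w (hargs w (by rw [hg]; exact hw))

theorem rename_mem_circuitClass [Field F] (f : σ → τ) {s d : ℕ} {D : MvPolynomial σ F}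
    (h : D ∈ circuitClass F σ s d) : MvPolynomial.rename f D ∈ circuitClass F τ s d := by
  obtain ⟨hd, C, hC, rfl⟩ := h
  exact ⟨(MvPolynomial.totalDegree_rename_le f _).trans hd, C.rename f,
    (C.size_rename f).trans_le hC, C.val_rename f _⟩

/-- The class is closed under permutations of the variables, so the numbering of the monomials is
immaterial and the machine may use its own. -/
theorem HasSuccinctHittingSet.of_equiv [Field F] {n d N s s' d' : ℕ} {φ : Monomials n d ≃ Fin N}
    (h : HasSuccinctHittingSet φ s (circuitClass F (Fin N) s' d')) (ψ : Monomials n d ≃ Fin N) :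
    HasSuccinctHittingSet ψ s (circuitClass F (Fin N) s' d') := by
  intro D hD hD0
  obtain ⟨_, ⟨f, hf, rfl⟩, hne⟩ := h (MvPolynomial.rename (ψ.symm.trans φ) D)
    (rename_mem_circuitClass _ hD)
    (fun h0 => hD0 (MvPolynomial.rename_injective _ (Equiv.injective _) (h0.trans (map_zero _).symm)))
  refine ⟨_, ⟨f, hf, rfl⟩, ?_⟩
  rw [MvPolynomial.eval_rename] at hne
  convert hne using 3
  funext i
  simp [coeffVec]

end Rename

/-! ### Kronecker substitution -/

/-- The exponent of the monomial `a` after the substitution of `X ^ (2 ^ n) ^ j` for `x_j`. -/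
def kroneckerCode {n : ℕ} (a : Fin n →₀ ℕ) : ℕ := ∑ j : Fin n, a j * (2 ^ n) ^ (j : ℕ)

/-- The codes of the monomials of degree at most `n` in `n` variables, in increasing order. -/
def kroneckerCodes (n : ℕ) : List ℕ :=
  (List.range (2 ^ (n * n))).filter fun i =>
    (∑ x ∈ Finset.range n, i / (2 ^ n) ^ x % 2 ^ n) ≤ n

/-- Exponents are genuine digits in base `2 ^ n`, which is what makes the code injective. -/
theorem Monomials.apply_lt {n : ℕ} (a : Monomials n n) (j : Fin n) : a.1 j < 2 ^ n :=
  ((Finsupp.le_degree j a.1).trans a.2).trans_lt Nat.lt_two_pow_self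

theorem kroneckerCode_eq {n : ℕ} (a : Monomials n n) :
    kroneckerCode a.1 =
      (finFunctionFinEquiv fun j => (⟨a.1 j, a.apply_lt j⟩ : Fin (2 ^ n)) : ℕ) := by
  rw [finFunctionFinEquiv_apply, kroneckerCode]

theorem kroneckerCode_digit {n : ℕ} (a : Monomials n n) (j : Fin n) :
    kroneckerCode a.1 / (2 ^ n) ^ (j : ℕ) % 2 ^ n = a.1 j := by
  rw [kroneckerCode_eq]
  exact congrArg Fin.val (congrFun
    (finFunctionFinEquiv.symm_apply_apply fun j => (⟨a.1 j, a.apply_lt j⟩ : Fin (2 ^ n))) j)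

theorem kroneckerCode_injective {n : ℕ} {a b : Monomials n n}
    (h : kroneckerCode a.1 = kroneckerCode b.1) : a = b :=
  Subtype.ext (Finsupp.ext fun j => by
    rw [← kroneckerCode_digit a j, ← kroneckerCode_digit b j, h])

theorem kroneckerCode_mem {n : ℕ} (a : Monomials n n) : kroneckerCode a.1 ∈ kroneckerCodes n := by
  rw [kroneckerCodes, List.mem_filter, List.mem_range]
  constructor
  · rw [pow_mul, kroneckerCode_eq]
    exact Fin.is_lt _
  · rw [decide_eq_true_eq, Finset.sum_range]
    simp only [kroneckerCode_digit]
    rw [← Finsupp.degree_eq_sum]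
    exact a.2

theorem exists_kroneckerCode_eq {n i : ℕ} (hi : i ∈ kroneckerCodes n) :
    ∃ a : Monomials n n, kroneckerCode a.1 = i := by
  rw [kroneckerCodes, List.mem_filter, List.mem_range, decide_eq_true_eq, pow_mul] at hi
  obtain ⟨h1, h2⟩ := hi
  refine ⟨⟨Finsupp.equivFunOnFinite.symm fun j : Fin n => i / (2 ^ n) ^ (j : ℕ) % 2 ^ n, ?_⟩, ?_⟩
  · rw [Finsupp.degree_eq_sum]
    rw [Finset.sum_range] at h2
    exact h2
  · rw [kroneckerCode_eq]
    exact congrArg Fin.val (finFunctionFinEquiv.apply_symm_apply ⟨i, h1⟩)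

theorem kroneckerCodes_nodup (n : ℕ) : (kroneckerCodes n).Nodup :=
  List.nodup_range.filter _

/-- Number the monomials by their codes. -/
noncomputable def kroneckerNumbering (n : ℕ) : Monomials n n ≃ Fin (kroneckerCodes n).length :=
  (Equiv.ofBijective
    (fun a : Monomials n n => (⟨kroneckerCode a.1, kroneckerCode_mem a⟩ : {i // i ∈ kroneckerCodes n}))
    ⟨fun _ _ h => kroneckerCode_injective (Subtype.ext_iff.1 h),
      fun i => (exists_kroneckerCode_eq i.2).imp fun _ h => Subtype.ext h⟩).trans
  ((kroneckerCodes_nodup n).getEquiv _).symm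

theorem kroneckerNumbering_symm (n : ℕ) (i : Fin (kroneckerCodes n).length) :
    (kroneckerCodes n).get i = kroneckerCode ((kroneckerNumbering n).symm i).1 := by
  obtain ⟨a, rfl⟩ := (kroneckerNumbering n).surjective i
  rw [Equiv.symm_apply_apply]
  have h := ((kroneckerCodes_nodup n).getEquiv _).apply_symm_apply
    ⟨kroneckerCode a.1, kroneckerCode_mem a⟩
  exact congrArg Subtype.val h

/-- All monomials of `f` have degree at most `n`, so none of them collides with `b`. -/
theorem coeff_kronecker {F : Type*} [Field F] {n : ℕ} {f : MvPolynomial (Fin n) F}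
    (hf : f.totalDegree ≤ n) (b : Monomials n n) :
    (MvPolynomial.aeval (fun j : Fin n => (Polynomial.X : Polynomial F) ^ 2 ^ (n * (j : ℕ))) f).coeff
      (kroneckerCode b.1) = f.coeff b.1 := by
  classical
  rw [MvPolynomial.aeval_def, MvPolynomial.eval₂_eq', Polynomial.finsetSum_coeff]
  have hterm : ∀ a : Fin n →₀ ℕ, (algebraMap F (Polynomial F) (f.coeff a) *
      ∏ j : Fin n, ((Polynomial.X : Polynomial F) ^ 2 ^ (n * (j : ℕ))) ^ a j).coeff (kroneckerCode b.1)
      = if kroneckerCode b.1 = kroneckerCode a then f.coeff a else 0 := by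
    intro a
    have : ∏ j : Fin n, ((Polynomial.X : Polynomial F) ^ 2 ^ (n * (j : ℕ))) ^ a j
        = Polynomial.X ^ kroneckerCode a := by
      rw [kroneckerCode, ← Finset.prod_pow_eq_pow_sum]
      exact Finset.prod_congr rfl fun j _ => by rw [← pow_mul, pow_mul 2, mul_comm]
    rw [this, Polynomial.algebraMap_eq, Polynomial.coeff_C_mul_X_pow]
  rw [Finset.sum_congr rfl fun a _ => hterm a]
  have hdeg : ∀ a ∈ f.support, a.degree ≤ n := fun a ha => by
    rw [Finsupp.degree_eq_sum, ← Finsupp.sum_fintype a (fun _ x => x) (fun _ => rfl)]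
    exact (MvPolynomial.le_totalDegree ha).trans hf
  rw [Finset.sum_eq_single b.1]
  · rw [if_pos rfl]
  · intro a ha hab
    rw [if_neg]
    intro h
    exact hab (congrArg Subtype.val (kroneckerCode_injective (a := b) (b := ⟨a, hdeg a ha⟩) h)).symm
  · intro hb
    rw [if_pos rfl]
    exact MvPolynomial.notMem_support_iff.1 hb

/-! ### The explicit hitting set -/

section Grid

variable {F : Type*} [Field F]

theorem totalDegree_aeval_le {σ τ : Type*} (g : σ → MvPolynomial τ F) {r : ℕ}
    (hg : ∀ i, (g i).totalDegree ≤ r) (D : MvPolynomial σ F) :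
    (MvPolynomial.aeval g D).totalDegree ≤ D.totalDegree * r := by
  rw [MvPolynomial.aeval_def, MvPolynomial.eval₂_eq]
  refine MvPolynomial.totalDegree_finsetSum_le fun a ha => ?_
  refine (MvPolynomial.totalDegree_mul _ _).trans ?_
  rw [MvPolynomial.algebraMap_eq, MvPolynomial.totalDegree_C, zero_add]
  refine (MvPolynomial.totalDegree_finsetProd _ _).trans ?_
  calc ∑ i ∈ a.support, (g i ^ a i).totalDegree
      ≤ ∑ i ∈ a.support, a i * r := Finset.sum_le_sum fun i _ =>
        (MvPolynomial.totalDegree_pow _ _).trans (Nat.mul_le_mul_left _ (hg i))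
    _ = (a.sum fun _ x => x) * r := by rw [Finsupp.sum, Finset.sum_mul]
    _ ≤ D.totalDegree * r := Nat.mul_le_mul_right _ (MvPolynomial.le_totalDegree ha)

/-- A non-zero polynomial of degree less than `L` is non-zero on the grid of the first `L`
elements. -/
theorem exists_eval_digits_ne_zero {e : ℕ → F} (he : IsEnumeration e) {m L : ℕ}
    {Q : MvPolynomial (Fin m) F} (hQ : Q.totalDegree < L) {y : Fin m → F}
    (hy : MvPolynomial.eval y Q ≠ 0) :
    ∃ v < L ^ m, MvPolynomial.eval (fun x : Fin m => e (v / L ^ (x : ℕ) % L)) Q ≠ 0 := by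
  classical
  suffices h : ∃ z : Fin m → Fin L, MvPolynomial.eval (fun x => e (z x)) Q ≠ 0 by
    obtain ⟨z, hz⟩ := h
    refine ⟨finFunctionFinEquiv z, Fin.is_lt _, ?_⟩
    convert hz using 4 with x
    exact congrArg (fun k : Fin L => e k) (congrFun (finFunctionFinEquiv.symm_apply_apply z) x)
  -- If the field has at most `L` elements, they all occur among the first `L`, and `y` itself is on
  -- the grid. Otherwise these `L` elements are distinct, and a polynomial of degree less than `L`
  -- in each variable cannot vanish on the whole grid without being zero.
  by_cases hcard : ENat.card F ≤ L
  · have hfin : Finite F := by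
      rw [← ENat.card_lt_top]
      exact hcard.trans_lt (ENat.natCast_lt_top L)
    have := Fintype.ofFinite F
    have hinj : Function.Injective fun k : Fin (Fintype.card F) => e k := fun a b hab =>
      Fin.ext (he (by simp [ENat.card_eq_coe_fintype_card]) (by simp [ENat.card_eq_coe_fintype_card]) hab)
    have hsurj := ((Fintype.bijective_iff_injective_and_card _).2
      ⟨hinj, Fintype.card_fin _⟩).surjective
    have hL : Fintype.card F ≤ L := by
      rw [ENat.card_eq_coe_fintype_card] at hcard
      exact_mod_cast hcard
    choose z hz using fun x => hsurj (y x)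
    refine ⟨fun x => Fin.castLE hL (z x), ?_⟩
    convert hy using 3 with x
    funext x
    exact hz x
  · have hinj : Set.InjOn e (Finset.range L) := he.mono fun k hk => by
      have hk' : k < L := by simpa using hk
      exact lt_trans (by exact_mod_cast hk') (not_le.1 hcard)
    have hne : Q ≠ 0 := fun h => hy (by rw [h, map_zero])
    by_contra! hall
    refine hne (MvPolynomial.eq_zero_of_eval_zero_at_prod_finset Q
      (fun _ => (Finset.range L).image e) (fun i => ?_) fun x hx => ?_)
    · rw [Finset.card_image_of_injOn hinj, Finset.card_range]
      exact (MvPolynomial.degreeOf_le_totalDegree Q i).trans_lt hQ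
    · choose z hz hzx using fun i => Finset.mem_image.1 (hx i)
      rw [← hall fun i => ⟨z i, Finset.mem_range.1 (hz i)⟩]
      congr 1
      congr 1
      funext i
      exact (hzx i).symm

/-- The `v`-th point of the hitting set: the parameters of the universal program of length `K` are
given by the digits of `v` in base `L`. -/
noncomputable def gridPoint (e : ℕ → F) (n K L v : ℕ) : Fin (kroneckerCodes n).length → F :=
  fun i => (universal (fun x => e (v / L ^ x % L)) (K - 1)).coeff ((kroneckerCodes n).get i)

theorem gridPoint_hits {e : ℕ → F} (he : IsEnumeration e) {n t s d K L V : ℕ}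
    {φ : Monomials n n ≃ Fin (kroneckerCodes n).length}
    (h : HasSuccinctHittingSet φ t (circuitClass F (Fin (kroneckerCodes n).length) s d))
    (hK : n * n + t + 3 ≤ K) (hL : d * 2 ^ K < L) (hV : L ^ paramOffset K ≤ V) :
    IsHittingSet {α | ∃ v < V, α = gridPoint e n K L v}
      (circuitClass F (Fin (kroneckerCodes n).length) s d) := by
  intro D hD hD0
  obtain ⟨_, ⟨f, ⟨hfn, C, hC, rfl⟩, rfl⟩, hne⟩ := h.of_equiv (kroneckerNumbering n) D hD hD0
  obtain ⟨y, hy⟩ := exists_universal_eq_circuit (fun j : Fin n => n * (j : ℕ)) (m := n * n)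
    (k := K - 1) (fun j => Nat.mul_le_mul_left _ j.2.le) C (by omega)
  set m := paramOffset K with hm
  -- Indeterminate parameters. The instructions up to index `K - 1` read only positions below `m =
  -- paramOffset K`, so the padding by `0` has no effect.
  let Y : ℕ → MvPolynomial (Fin m) F := fun x => if hx : x < m then MvPolynomial.X ⟨x, hx⟩ else 0
  have hYdeg : ∀ x, (Y x).totalDegree ≤ 1 := fun x => by
    simp only [Y]
    split_ifs
    · rw [MvPolynomial.totalDegree_X]
    · simp
  let Q : MvPolynomial (Fin m) F := MvPolynomial.aeval
    (fun i => (universal Y (K - 1)).coeff ((kroneckerCodes n).get i)) D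
  have hQ : Q.totalDegree < L := by
    refine (totalDegree_aeval_le _ (fun i => totalDegree_coeff_universal Y hYdeg _ _) D).trans_lt ?_
    refine lt_of_le_of_lt (Nat.mul_le_mul hD.1 ?_) hL
    exact (Nat.sub_le _ _).trans (Nat.pow_le_pow_right (by norm_num) (by omega))
  have heval : ∀ z : ℕ → F, MvPolynomial.eval (fun x : Fin m => z x) Q =
      MvPolynomial.eval (fun i => (universal z (K - 1)).coeff ((kroneckerCodes n).get i)) D := by
    intro z
    have hu : (universal Y (K - 1)).map (MvPolynomial.eval fun x : Fin m => z x)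
        = universal z (K - 1) := by
      rw [universal_map]
      refine universal_congr _ fun x hx => ?_
      rw [Nat.sub_add_cancel (by omega)] at hx
      simp only [Y]
      rw [dif_pos (hm ▸ hx), MvPolynomial.eval_X]
    simp only [Q]
    rw [MvPolynomial.aeval_def, MvPolynomial.algebraMap_eq, MvPolynomial.eval_eval₂,
      ← hu]
    simp only [Polynomial.coeff_map]
    rw [MvPolynomial.eval, MvPolynomial.coe_eval₂Hom]
    congr 1
    ext a
    simp
  -- At the parameters simulating the circuit for `f`, the value of `Q` is that of `D` at the
  -- coefficient vector of `f`.
  have hQne : MvPolynomial.eval (fun x : Fin m => y x) Q ≠ 0 := by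
    rw [heval]
    convert hne using 3
    funext i
    rw [hy, kroneckerNumbering_symm, coeff_kronecker hfn]
    rfl
  obtain ⟨v, hv, hvQ⟩ := exists_eval_digits_ne_zero he hQ hQne
  rw [heval fun x => e (v / L ^ x % L)] at hvQ
  exact ⟨_, ⟨v, hv.trans_le hV, rfl⟩, hvQ⟩

end Grid

/-! ### Reasoning about programs -/

section Programs

variable {F : Type*} [Field F] {e : ℕ → F}

/-- Started in `S`, the program `p` halts within `τ` steps in a state with the property `Q`. -/
def Ends (e : ℕ → F) (p : Prog) (S : State F) (τ : ℕ) (Q : State F → Prop) : Prop :=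
  ∃ T ≤ τ, ∃ S', Runs e p S T S' ∧ Q S'

theorem Ends.mono {p : Prog} {S : State F} {τ τ' : ℕ} {Q Q' : State F → Prop}
    (h : Ends e p S τ Q) (hτ : τ ≤ τ') (hQ : ∀ S, Q S → Q' S) : Ends e p S τ' Q' := by
  obtain ⟨T, hT, S', hr, hq⟩ := h
  exact ⟨T, hT.trans hτ, S', hr, hQ _ hq⟩

theorem Ends.skip {S : State F} {Q : State F → Prop} (h : Q S) : Ends e .skip S 1 Q :=
  ⟨1, le_rfl, S, .skip S, h⟩

theorem Ends.setN {a v : NExp} {S : State F} {Q : State F → Prop}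
    (h : Q { S with nat := Function.update S.nat (a.eval S.nat) (v.eval S.nat) }) :
    Ends e (.setN a v) S 1 Q :=
  ⟨1, le_rfl, _, .setN a v S, h⟩

theorem Ends.setF {a : NExp} {v : FExp} {S : State F} {Q : State F → Prop}
    (h : Q { S with fld := Function.update S.fld (a.eval S.nat) (v.eval e S) }) :
    Ends e (.setF a v) S 1 Q :=
  ⟨1, le_rfl, _, .setF a v S, h⟩

theorem Ends.print {v : FExp} {S : State F} {Q : State F → Prop}
    (h : Q { S with out := S.out ++ [v.eval e S] }) : Ends e (.print v) S 1 Q :=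
  ⟨1, le_rfl, _, .print v S, h⟩

theorem Ends.seq {p q : Prog} {S : State F} {τ₁ τ₂ : ℕ} {Q : State F → Prop}
    (h : Ends e p S τ₁ fun S' => Ends e q S' τ₂ Q) : Ends e (.seq p q) S (τ₁ + τ₂) Q := by
  obtain ⟨T₁, h₁, S₁, r₁, T₂, h₂, S₂, r₂, hq⟩ := h
  exact ⟨T₁ + T₂, Nat.add_le_add h₁ h₂, S₂, .seq r₁ r₂, hq⟩

theorem Ends.ite {c : NExp} {p q : Prog} {S : State F} {τ : ℕ} {Q : State F → Prop}
    (h₁ : c.eval S.nat ≠ 0 → Ends e p S τ Q) (h₂ : c.eval S.nat = 0 → Ends e q S τ Q) :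
    Ends e (.ite c p q) S (τ + 1) Q := by
  by_cases hc : c.eval S.nat = 0
  · obtain ⟨T, hT, S', hr, hq⟩ := h₂ hc
    exact ⟨T + 1, Nat.succ_le_succ hT, S', .ite_false hc hr, hq⟩
  · obtain ⟨T, hT, S', hr, hq⟩ := h₁ hc
    exact ⟨T + 1, Nat.succ_le_succ hT, S', .ite_true hc hr, hq⟩

/-- The time for `N` rounds of a loop with a body taking `τ` steps. -/
def loopTime (N τ : ℕ) : ℕ := N * (τ + 1) + 1

theorem loopTime_mono {N N' τ τ' : ℕ} (h : N ≤ N') (h' : τ ≤ τ') :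
    loopTime N τ ≤ loopTime N' τ' :=
  Nat.succ_le_succ (Nat.mul_le_mul h (Nat.succ_le_succ h'))

/-- The invariant is indexed by the number of completed rounds, so it yields correctness and the
time bound together. The induction is on the remaining rounds. -/
theorem Ends.while {c : NExp} {p : Prog} {τ : ℕ} (I : ℕ → State F → Prop) (N : ℕ)
    (hstep : ∀ k < N, ∀ S, I k S → c.eval S.nat ≠ 0 ∧ Ends e p S τ (I (k + 1)))
    (hend : ∀ S, I N S → c.eval S.nat = 0) {S : State F} (h0 : I 0 S) :
    Ends e (.while c p) S (loopTime N τ) (I N) := by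
  suffices h : ∀ k ≤ N, ∀ S, I (N - k) S → Ends e (.while c p) S (loopTime k τ) (I N) from
    h N le_rfl S (by rwa [Nat.sub_self])
  intro k
  induction k with
  | zero =>
    intro _ S hS
    exact ⟨1, by simp [loopTime], S, .while_false (hend S hS), hS⟩
  | succ k ih =>
    intro hk S hS
    obtain ⟨hc, T, hT, S', hr, hI⟩ := hstep _ (by omega) S hS
    rw [show N - (k + 1) + 1 = N - k by omega] at hI
    obtain ⟨T', hT', S'', hr', hI'⟩ := ih (by omega) S' hI
    refine ⟨T + T' + 1, ?_, S'', .while_true hc hr hr', hI'⟩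
    rw [loopTime] at hT' ⊢
    rw [Nat.succ_mul]
    omega

/-- A loop that passes through a known sequence of states. -/
theorem Ends.while_eq {c : NExp} {p : Prog} {τ : ℕ} (St : ℕ → State F) (N : ℕ)
    (hstep : ∀ k < N, c.eval (St k).nat ≠ 0 ∧ Ends e p (St k) τ (· = St (k + 1)))
    (hend : c.eval (St N).nat = 0) {S : State F} (h0 : S = St 0) :
    Ends e (.while c p) S (loopTime N τ) (· = St N) :=
  Ends.while (fun k S => S = St k) N (fun k hk _ hS => hS ▸ hstep k hk) (fun _ hS => hS ▸ hend) h0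

/-! ### Arithmetic of natural numbers -/

/-- The content of the cell with the fixed address `k`. -/
abbrev cell (k : ℕ) : NExp := .mem (.lit k)

/-- Divide cell `x` by cell `b`: the quotient goes to cell `q`, and the remainder to cell `x`. -/
def divProg (x b q : ℕ) : Prog :=
  .seq (.setN (.lit q) (.lit 0)) <|
  .while (.sub (.add (cell x) (.lit 1)) (cell b)) <|
  .seq (.setN (.lit x) (.sub (cell x) (cell b)))
    (.setN (.lit q) (.add (cell q) (.lit 1)))

theorem divProg_ends {x b q : ℕ} (hxb : x ≠ b) (hqx : q ≠ x) (hqb : q ≠ b) (S : State F)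
    (hb : 0 < S.nat b) {t : ℕ} (ht : S.nat x ≤ t) :
    Ends e (divProg x b q) S (1 + loopTime t 2) (fun S' => S' = { S with
      nat := Function.update (Function.update S.nat q (S.nat x / S.nat b)) x
        (S.nat x % S.nat b) }) := by
  refine Ends.seq (Ends.setN ?_)
  -- With truncated subtraction, the test `x + 1 - b` is non-zero exactly when `b ≤ x`.
  refine (Ends.while_eq (fun k => { S with
    nat := Function.update (Function.update S.nat q k) x (S.nat x - k * S.nat b) })
    (S.nat x / S.nat b) (τ := 2) (fun k hk => ⟨?_, ?_⟩) ?_ ?_).mono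
    (loopTime_mono ((Nat.div_le_self _ _).trans ht) le_rfl) ?_
  · have h1 : (k + 1) * S.nat b ≤ S.nat x :=
      (Nat.mul_le_mul_right _ hk).trans (Nat.div_mul_le_self _ _)
    rw [Nat.succ_mul] at h1
    simp [NExp.eval, Function.update_of_ne hxb.symm, Function.update_of_ne hqb.symm]
    omega
  · refine Ends.seq (Ends.setN (Ends.setN ?_))
    simp only [NExp.eval, Function.update_self, Function.update_of_ne hxb.symm,
      Function.update_of_ne hqb.symm, Function.update_of_ne hqx, Function.update_idem]
    congr 1
    rw [Function.update_comm hqx.symm, Function.update_idem, Nat.succ_mul, Nat.sub_sub]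
  · have h1 := Nat.div_add_mod (S.nat x) (S.nat b)
    have h2 := Nat.mod_lt (S.nat x) hb
    rw [mul_comm] at h1
    simp [NExp.eval, Function.update_of_ne hxb.symm, Function.update_of_ne hqb.symm]
    omega
  · simp [NExp.eval, Function.update_of_ne hqx.symm]
  · rintro S' rfl
    have h1 := Nat.div_add_mod (S.nat x) (S.nat b)
    rw [mul_comm] at h1
    congr 2
    omega

/-- Add cell `y` to the cell `z` as often as cell `c` says, and clear cell `c`. -/
def addLoop (z y c : ℕ) : Prog :=
  .while (cell c) <|
  .seq (.setN (.lit z) (.add (cell z) (cell y)))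
    (.setN (.lit c) (.sub (cell c) (.lit 1)))

/-- Put the product of the cells `x` and `y` into cell `z`, using cell `c`. -/
def mulProg (z x y c : ℕ) : Prog :=
  .seq (.setN (.lit z) (.lit 0)) <| .seq (.setN (.lit c) (cell x)) <| addLoop z y c

theorem mulProg_ends {z x y c : ℕ} (hzx : z ≠ x) (hzy : z ≠ y) (hcz : c ≠ z) (hcy : c ≠ y)
    (S : State F) {t : ℕ} (ht : S.nat x ≤ t) :
    Ends e (mulProg z x y c) S (1 + (1 + loopTime t 2)) (fun S' => S' = { S with
      nat := Function.update (Function.update S.nat z (S.nat x * S.nat y)) c 0 }) := by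
  refine Ends.seq (Ends.setN (Ends.seq (Ends.setN ?_)))
  refine (Ends.while_eq (fun k => { S with
    nat := Function.update (Function.update S.nat z (k * S.nat y)) c (S.nat x - k) })
    (S.nat x) (τ := 2) (fun k hk => ⟨?_, ?_⟩) ?_ ?_).mono (loopTime_mono ht le_rfl) ?_
  · simp [NExp.eval]
    omega
  · refine Ends.seq (Ends.setN (Ends.setN ?_))
    simp only [NExp.eval, Function.update_self, Function.update_of_ne hcy.symm,
      Function.update_of_ne hzy.symm, Function.update_of_ne hcz, Function.update_of_ne hcz.symm]
    congr 1
    rw [Function.update_comm hcz, Function.update_idem, Function.update_idem, Nat.succ_mul, Nat.sub_sub]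
  · simp [NExp.eval]
  · simp [NExp.eval, Function.update_of_ne hzx.symm]
  · rintro S' rfl
    simp

/-- Put `2 ^ x` into cell `z`, where `x` is the content of cell `x`, using cell `c`. -/
def twoPowProg (z x c : ℕ) : Prog :=
  .seq (.setN (.lit z) (.lit 1)) <| .seq (.setN (.lit c) (cell x)) <| addLoop z z c

theorem twoPowProg_ends {z x c : ℕ} (hzx : z ≠ x) (hcz : c ≠ z) (S : State F) {t : ℕ}
    (ht : S.nat x ≤ t) :
    Ends e (twoPowProg z x c) S (1 + (1 + loopTime t 2)) (fun S' => S' = { S with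
      nat := Function.update (Function.update S.nat z (2 ^ S.nat x)) c 0 }) := by
  refine Ends.seq (Ends.setN (Ends.seq (Ends.setN ?_)))
  -- Here the loop adds the cell `z` to itself, doubling it in each round.
  refine (Ends.while_eq (fun k => { S with
    nat := Function.update (Function.update S.nat z (2 ^ k)) c (S.nat x - k) })
    (S.nat x) (τ := 2) (fun k hk => ⟨?_, ?_⟩) ?_ ?_).mono (loopTime_mono ht le_rfl) ?_
  · simp [NExp.eval]
    omega
  · refine Ends.seq (Ends.setN (Ends.setN ?_))
    simp only [NExp.eval, Function.update_self, Function.update_of_ne hcz,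
      Function.update_of_ne hcz.symm]
    congr 1
    rw [Function.update_comm hcz, Function.update_idem, Function.update_idem, pow_succ, mul_two, Nat.sub_sub]
  · simp [NExp.eval]
  · simp [NExp.eval, Function.update_of_ne hzx.symm]
  · rintro S' rfl
    simp

/-! ### Registers -/

/-- A memory with the given first cells, and zeros after them. -/
def registers (l : List ℕ) : ℕ → ℕ := fun a => l.getD a 0

theorem registers_apply (l : List ℕ) (a : ℕ) : registers l a = l.getD a 0 := rfl

theorem update_registers (l : List ℕ) {a : ℕ} (x : ℕ) (h : a < l.length) :
    Function.update (registers l) a x = registers (l.set a x) := by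
  funext b
  rw [Function.update_apply, registers_apply, registers_apply, List.getD_eq_getElem?_getD,
    List.getD_eq_getElem?_getD, List.getElem?_set]
  by_cases hab : b = a
  · subst hab
    simp [h]
  · simp [hab, Ne.symm hab]

/-- The register file of the program below. -/
abbrev regs (n B M K L V Z v w p j l i u q : ℕ) : ℕ → ℕ :=
  registers [n, B, M, K, L, V, Z, v, w, p, j, l, i, u, q]

variable {n B M K L V Z v w p j l i u q : ℕ} {f : ℕ → F} {o : List F}

/-! ### Arithmetic of polynomials -/

/-- Add one coefficient of a product to a cell. -/
def convCell : Prog :=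
  .while (.sub (.add (cell 12) (.lit 1)) (cell 13)) <|
  .seq (.setF (.add (cell 9) (cell 12)) (.add (.mem (.add (cell 9) (cell 12)))
      (.mul (.elt (cell 8)) (.mul (.mem (.add (cell 10) (cell 13)))
        (.mem (.add (cell 11) (.sub (cell 12) (cell 13))))))))
    (.setN (.lit 13) (.add (cell 13) (.lit 1)))

/-- In the main loop, `B = 2 ^ n` is the Kronecker base, `M` the number of coefficients kept, `Z = K
* M` the memory in use, and `w` what remains of the digits of `v`. The polynomials starting at `j`
and `l` are multiplied into the one at `p`. Both factors end before `p`, so writing never disturbs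
what is still to be read. -/
theorem convCell_ends (hi : i < M) (hj : j + M ≤ p) (hl : l + M ≤ p) :
    Ends e convCell ⟨regs n B M K L V Z v w p j l i 0 q, f, o⟩ (loopTime M 2)
      (· = ⟨regs n B M K L V Z v w p j l i (i + 1) q, Function.update f (p + i) (f (p + i) +
        ∑ u ∈ Finset.range (i + 1), e w * (f (j + u) * f (l + (i - u)))), o⟩) := by
  refine (Ends.while_eq (fun k => ⟨regs n B M K L V Z v w p j l i k q,
    Function.update f (p + i) (f (p + i) +
        ∑ u ∈ Finset.range k, e w * (f (j + u) * f (l + (i - u)))), o⟩)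
    (i + 1) (τ := 2) (fun k hk => ⟨?_, ?_⟩) ?_ ?_).mono (loopTime_mono hi le_rfl) fun _ h => h
  · simp [NExp.eval, registers_apply]
    omega
  · refine Ends.seq (Ends.setF (Ends.setN ?_))
    have h1 : j + k ≠ p + i := by omega
    have h2 : l + (i - k) ≠ p + i := by omega
    simp [NExp.eval, FExp.eval, registers_apply, update_registers, Finset.sum_range_succ,
      Function.update_of_ne h1, Function.update_of_ne h2, add_assoc]
  · simp [NExp.eval, registers_apply]
  · simp

/-- Add a multiple of a product of two polynomials to a third one. -/
def convProg : Prog :=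
  .seq (.setN (.lit 12) (.lit 0)) <|
  .while (.sub (cell 2) (cell 12)) <|
  .seq (.setN (.lit 13) (.lit 0)) <|
  .seq convCell (.setN (.lit 12) (.add (cell 12) (.lit 1)))

/-- The memory after adding the first `m` coefficients of a multiple of a product of two
polynomials. -/
def convMem (f : ℕ → F) (c : F) (p j l m : ℕ) : ℕ → F := fun x =>
  if p ≤ x ∧ x < p + m then
    f x + ∑ u ∈ Finset.range (x - p + 1), c * (f (j + u) * f (l + (x - p - u)))
  else f x

theorem convProg_ends (hj : j + M ≤ p) (hl : l + M ≤ p) :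
    Ends e convProg ⟨regs n B M K L V Z v w p j l i u q, f, o⟩
      (1 + loopTime M (1 + (loopTime M 2 + 1)))
      (fun S => ∃ u', S = ⟨regs n B M K L V Z v w p j l M u' q, convMem f (e w) p j l M, o⟩) := by
  refine Ends.seq (Ends.setN ?_)
  refine Ends.while (fun k S => ∃ u',
    S = ⟨regs n B M K L V Z v w p j l k u' q, convMem f (e w) p j l k, o⟩) M ?_ ?_ ?_
  · rintro k hk _ ⟨u', rfl⟩
    refine ⟨?_, Ends.seq (Ends.setN (Ends.seq ?_))⟩
    · simp [NExp.eval, registers_apply]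
      omega
    simp only [NExp.eval]
    rw [update_registers _ _ (by simp)]
    refine (convCell_ends hk hj hl).mono le_rfl ?_
    rintro _ rfl
    refine Ends.setN ⟨k + 1, ?_⟩
    simp only [NExp.eval]
    rw [update_registers _ _ (by simp)]
    congr 1
    funext x
    have hold : ∀ x, x < p → convMem f (e w) p j l k x = f x := fun x hx =>
      if_neg fun h => by omega
    have hsum : ∑ u ∈ Finset.range (k + 1), e w * (convMem f (e w) p j l k (j + u) *
        convMem f (e w) p j l k (l + (k - u)))
        = ∑ u ∈ Finset.range (k + 1), e w * (f (j + u) * f (l + (k - u))) :=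
      Finset.sum_congr rfl fun u hu => by
        rw [Finset.mem_range] at hu
        rw [hold _ (by omega), hold _ (by omega)]
    rw [hsum, Function.update_apply]
    by_cases hx : x = p + k
    · subst hx
      rw [if_pos rfl, convMem, if_neg (by omega), convMem, if_pos (by omega),
        Nat.add_sub_cancel_left]
    · rw [if_neg hx, convMem, convMem]
      exact if_congr (by omega) rfl rfl
  · rintro _ ⟨u', rfl⟩
    simp [NExp.eval, registers_apply]
  · refine ⟨u, ?_⟩
    simp only [NExp.eval]
    rw [update_registers _ _ (by simp)]
    congr 1
    funext x
    exact (if_neg (by omega)).symm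

end Programs

/-! ### The universal program on the machine -/

section Universal

variable {F : Type*} [Field F] {e : ℕ → F}

/-- The memory `f` holds the first `M` coefficients of the first `k` results of the universal
program and those of `a`, and zeros after them. -/
structure Tracks (y : ℕ → F) (M Z k : ℕ) (a : Polynomial F) (f : ℕ → F) : Prop where
  old : ∀ j < k, ∀ i < M, f (j * M + i) = (universal y j).coeff i
  cur : ∀ i < M, k * M + i < Z → f (k * M + i) = a.coeff i
  new : ∀ x, (k + 1) * M ≤ x → x < Z → f x = 0

variable {y : ℕ → F} {n B M K L V Z v w p j l i u q k : ℕ} {f : ℕ → F} {o : List F}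

/-- Truncation is harmless: the first `M` coefficients of a product depend only on those of the
factors. -/
theorem Tracks.conv {a : Polynomial F} (h : Tracks y M Z k a f) (hj : j < k) (hl : l < k) (c : F) :
    Tracks y M Z k (a + Polynomial.C c * (universal y j * universal y l))
      (convMem f c (k * M) (j * M) (l * M) M) where
  old m hm i hi := by
    have : (m + 1) * M ≤ k * M := Nat.mul_le_mul_right _ hm
    rw [Nat.succ_mul] at this
    rw [convMem, if_neg (by omega), h.old m hm i hi]
  cur i hi hZ := by
    rw [convMem, if_pos (by omega), h.cur i hi hZ, Nat.add_sub_cancel_left, Polynomial.coeff_add,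
      Polynomial.coeff_C_mul, Polynomial.coeff_mul,
      Finset.Nat.sum_antidiagonal_eq_sum_range_succ_mk, Finset.mul_sum]
    congr 1
    refine Finset.sum_congr rfl fun u hu => ?_
    rw [Finset.mem_range] at hu
    rw [h.old j hj u (by omega), h.old l hl (i - u) (by omega)]
  new x hx hZ := by
    rw [convMem, if_neg (by rw [Nat.succ_mul] at hx; omega), h.new x hx hZ]

/-- The following block is still zero and serves as the empty sum. After the last instruction no
block is left, and the bounds by `Z` make the conditions on it vacuous. -/
theorem Tracks.next (h : Tracks y M Z k (universal y k) f) (hk : (k + 1) * M ≤ Z) :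
    Tracks y M Z (k + 1) 0 f where
  old m hm i hi := by
    rcases Nat.lt_or_ge m k with hmk | hmk
    · exact h.old m hmk i hi
    · obtain rfl : m = k := by omega
      exact h.cur i hi (by rw [Nat.succ_mul] at hk; omega)
  cur i _ hZ := by
    rw [h.new _ (by omega) hZ, Polynomial.coeff_zero]
  new x hx hZ := h.new x (by rw [Nat.succ_mul] at hx; omega) hZ

theorem Tracks.init (y : ℕ → F) (hM : 2 ≤ M) (hZ : 2 * M ≤ Z) (f : ℕ → F) :
    Tracks y M Z 2 0 (Function.update (Function.update (fun x => if x < Z then 0 else f x) 0 1)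
      (M + 1) 1) where
  old j hj i hi := by
    interval_cases j
    · rw [Function.update_of_ne (by omega), Function.update_apply, universal_zero,
        Polynomial.coeff_one]
      exact if_congr (by omega) rfl (if_pos (by omega))
    · rw [Function.update_apply, universal_one, Polynomial.coeff_X]
      refine if_congr (by omega) rfl ?_
      rw [Function.update_of_ne (by omega), if_pos (by omega)]
  cur i hi hZ := by
    rw [Function.update_of_ne (by omega), Function.update_of_ne (by omega), if_pos hZ,
      Polynomial.coeff_zero]
  new x hx hZ := by
    rw [Function.update_of_ne (by omega), Function.update_of_ne (by omega), if_pos hZ]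

/-- The time for adding a product of polynomials of length `M`. -/
def convTime (M : ℕ) : ℕ := 1 + loopTime M (1 + (loopTime M 2 + 1))

/-- Add the products of a polynomial with all preceding ones to the current one. -/
def rowProg : Prog :=
  .seq (.setN (.lit 11) (.lit 0)) <|
  .while (.sub (cell 9) (cell 11)) <|
  .seq (divProg 8 4 14) <|
  .seq convProg <|
  .seq (.setN (.lit 8) (cell 14))
    (.setN (.lit 11) (.add (cell 11) (cell 2)))

/-- The time for `rowProg`. -/
def rowTime (M K V : ℕ) : ℕ :=
  1 + loopTime K ((1 + loopTime V 2) + (convTime M + (1 + 1)))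

/-- Parameters are consumed in the order of their positions. Each division by `L` splits off the
current parameter as remainder and leaves the later ones as quotient. -/
theorem rowProg_ends (hM : 0 < M) (hL : 0 < L) (hkK : k ≤ K) (hj : j < k) (hv : v ≤ V)
    {a : Polynomial F} (hf : Tracks (fun x => e (v / L ^ x % L)) M Z k a f) :
    Ends e rowProg
      ⟨regs n B M K L V Z v (v / L ^ (paramOffset k + j * k)) (k * M) (j * M) l i u q, f, o⟩
      (rowTime M K V)
      (fun S => ∃ l' i' u' q' f', S = ⟨regs n B M K L V Z v
          (v / L ^ (paramOffset k + (j + 1) * k)) (k * M) (j * M) l' i' u' q', f', o⟩ ∧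
        Tracks (fun x => e (v / L ^ x % L)) M Z k (a + ∑ l ∈ Finset.range k,
          Polynomial.C (e (v / L ^ (paramOffset k + j * k + l) % L)) *
            (universal (fun x => e (v / L ^ x % L)) j *
              universal (fun x => e (v / L ^ x % L)) l)) f') := by
  refine Ends.seq (Ends.setN ?_)
  refine (Ends.while (fun m S => ∃ i' u' q' f', S = ⟨regs n B M K L V Z v
      (v / L ^ (paramOffset k + j * k + m)) (k * M) (j * M) (m * M) i' u' q', f', o⟩ ∧
    Tracks (fun x => e (v / L ^ x % L)) M Z k (a + ∑ l ∈ Finset.range m,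
      Polynomial.C (e (v / L ^ (paramOffset k + j * k + l) % L)) *
        (universal (fun x => e (v / L ^ x % L)) j * universal (fun x => e (v / L ^ x % L)) l)) f')
    k ?_ ?_ ?_).mono (loopTime_mono hkK le_rfl) ?_
  · rintro m hm _ ⟨i', u', q', f', rfl, hf'⟩
    have hmk : (m + 1) * M ≤ k * M := Nat.mul_le_mul_right _ hm
    have hjk : (j + 1) * M ≤ k * M := Nat.mul_le_mul_right _ hj
    rw [Nat.succ_mul] at hmk hjk
    refine ⟨?_, Ends.seq ((divProg_ends (by decide) (by decide) (by decide) _ hL (t := V)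
      ((Nat.div_le_self _ _).trans hv)).mono le_rfl ?_)⟩
    · simp [NExp.eval, registers_apply]
      omega
    rintro _ rfl
    refine Ends.seq ?_
    simp only [update_registers, List.length_cons, List.length_nil, Nat.reduceAdd, Nat.reduceLT,
      List.set_cons_succ, List.set_cons_zero, registers_apply, List.getD_cons_succ,
      List.getD_cons_zero]
    refine (convProg_ends hjk hmk).mono le_rfl ?_
    rintro _ ⟨u'', rfl⟩
    refine Ends.seq (Ends.setN (Ends.setN ⟨M, u'', v / L ^ (paramOffset k + j * k + m) / L,
      convMem f' (e (v / L ^ (paramOffset k + j * k + m) % L)) (k * M) (j * M) (m * M) M, ?_, ?_⟩))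
    swap
    · rw [Finset.sum_range_succ, ← add_assoc]
      exact hf'.conv hj hm _
    · simp [NExp.eval, update_registers, registers_apply, Nat.succ_mul, Nat.div_div_eq_div_mul,
        pow_succ, ← add_assoc]
  · rintro _ ⟨i', u', q', f', rfl, -⟩
    simp [NExp.eval, registers_apply]
  · refine ⟨i, u, q, f, ?_, by simpa using hf⟩
    simp [NExp.eval, update_registers]
  · rintro _ ⟨i', u', q', f', rfl, hf'⟩
    exact ⟨_, _, _, _, _, by rw [Nat.succ_mul, ← add_assoc], hf'⟩

/-- Carry out one instruction of the universal program. -/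
def instrProg : Prog :=
  .seq (.setN (.lit 10) (.lit 0)) <|
  .while (.sub (cell 9) (cell 10)) <|
  .seq rowProg (.setN (.lit 10) (.add (cell 10) (cell 2)))

theorem instrProg_ends (hM : 0 < M) (hL : 0 < L) (hk : 2 ≤ k) (hkK : k ≤ K) (hv : v ≤ V)
    (hf : Tracks (fun x => e (v / L ^ x % L)) M Z k 0 f) :
    Ends e instrProg
      ⟨regs n B M K L V Z v (v / L ^ paramOffset k) (k * M) j l i u q, f, o⟩
      (1 + loopTime K (rowTime M K V + 1))
      (fun S => ∃ j' l' i' u' q' f', S = ⟨regs n B M K L V Z v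
          (v / L ^ paramOffset (k + 1)) (k * M) j' l' i' u' q', f', o⟩ ∧
        Tracks (fun x => e (v / L ^ x % L)) M Z k (universal (fun x => e (v / L ^ x % L)) k) f') := by
  refine Ends.seq (Ends.setN ?_)
  refine (Ends.while (fun m S => ∃ l' i' u' q' f', S = ⟨regs n B M K L V Z v
      (v / L ^ (paramOffset k + m * k)) (k * M) (m * M) l' i' u' q', f', o⟩ ∧
    Tracks (fun x => e (v / L ^ x % L)) M Z k (∑ j ∈ Finset.range m, ∑ l ∈ Finset.range k,
      Polynomial.C (e (v / L ^ (paramOffset k + j * k + l) % L)) *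
        (universal (fun x => e (v / L ^ x % L)) j * universal (fun x => e (v / L ^ x % L)) l)) f')
    k ?_ ?_ ?_).mono (loopTime_mono hkK le_rfl) ?_
  · rintro m hm _ ⟨l', i', u', q', f', rfl, hf'⟩
    have hmk : (m + 1) * M ≤ k * M := Nat.mul_le_mul_right _ hm
    rw [Nat.succ_mul] at hmk
    refine ⟨?_, Ends.seq ((rowProg_ends hM hL hkK hm hv hf').mono le_rfl ?_)⟩
    · simp [NExp.eval, registers_apply]
      omega
    rintro _ ⟨l'', i'', u'', q'', f'', rfl, hf''⟩
    refine Ends.setN ⟨l'', i'', u'', q'', f'', ?_, ?_⟩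
    · simp [NExp.eval, update_registers, registers_apply, Nat.succ_mul]
    · rwa [Finset.sum_range_succ]
  · rintro _ ⟨l', i', u', q', f', rfl, -⟩
    simp [NExp.eval, registers_apply]
  · refine ⟨l, i, u, q, f, ?_, by simpa using hf⟩
    simp [NExp.eval, update_registers]
  · rintro _ ⟨l', i', u', q', f', rfl, hf'⟩
    -- The `k` rows have consumed `k * k` digits, exactly the block of this instruction.
    refine ⟨_, _, _, _, _, _, by rw [paramOffset_succ hk, sq], ?_⟩
    rwa [universal_eq _ hk]

/-- Clear the first cells of the memory of field elements. -/
def clearProg : Prog :=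
  .seq (.setN (.lit 12) (.lit 0)) <|
  .while (.sub (cell 6) (cell 12)) <|
  .seq (.setF (cell 12) .zero) (.setN (.lit 12) (.add (cell 12) (.lit 1)))

theorem clearProg_ends :
    Ends e clearProg ⟨regs n B M K L V Z v w p j l i u q, f, o⟩ (1 + loopTime Z 2)
      (· = ⟨regs n B M K L V Z v w p j l Z u q, fun x => if x < Z then 0 else f x, o⟩) := by
  refine Ends.seq (Ends.setN ?_)
  refine (Ends.while_eq (fun k => ⟨regs n B M K L V Z v w p j l k u q,
    fun x => if x < k then 0 else f x, o⟩) Z (fun k hk => ⟨?_, ?_⟩) ?_ ?_)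
  · simp [NExp.eval, registers_apply]
    omega
  · refine Ends.seq (Ends.setF (Ends.setN ?_))
    simp only [NExp.eval, FExp.eval, update_registers, List.length_cons, List.length_nil,
      Nat.reduceAdd, Nat.reduceLT, List.set_cons_succ, List.set_cons_zero, registers_apply,
      List.getD_cons_succ, List.getD_cons_zero]
    congr 1
    funext x
    rw [Function.update_apply]
    grind
  · simp [NExp.eval, registers_apply]
  · simp [NExp.eval, update_registers]

/-- Carry out the universal program, its parameters being given by the digits of cell `7`. -/
def universalProg : Prog :=
  .seq clearProg <|
  .seq (.setF (.lit 0) .one) <|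
  .seq (.setF (.add (cell 2) (.lit 1)) .one) <|
  .seq (.setN (.lit 8) (cell 7)) <|
  .seq (.setN (.lit 9) (.add (cell 2) (cell 2))) <|
  .while (.sub (cell 6) (cell 9)) <|
  .seq instrProg (.setN (.lit 9) (.add (cell 9) (cell 2)))

/-- The time for `universalProg`. -/
def universalTime (M K V Z : ℕ) : ℕ :=
  1 + loopTime Z 2 + (1 + (1 + (1 + (1 + loopTime K (1 + loopTime K (rowTime M K V + 1) + 1)))))

theorem universalProg_ends (hM : 2 ≤ M) (hL : 0 < L) (hK : 2 ≤ K) (hv : v ≤ V) :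
    Ends e universalProg ⟨regs n B M K L V (K * M) v w p j l i u q, f, o⟩
      (universalTime M K V (K * M))
      (fun S => ∃ w' p' j' l' i' u' q' f', S = ⟨regs n B M K L V (K * M) v
          w' p' j' l' i' u' q', f', o⟩ ∧
        Tracks (fun x => e (v / L ^ x % L)) M (K * M) K 0 f') := by
  refine Ends.seq (clearProg_ends.mono le_rfl ?_)
  rintro _ rfl
  refine Ends.seq (Ends.setF (Ends.seq (Ends.setF (Ends.seq (Ends.setN (Ends.seq (Ends.setN ?_)))))))
  refine (Ends.while (fun m S => ∃ j' l' i' u' q' f', S = ⟨regs n B M K L V (K * M) v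
      (v / L ^ paramOffset (m + 2)) ((m + 2) * M) j' l' i' u' q', f', o⟩ ∧
    Tracks (fun x => e (v / L ^ x % L)) M (K * M) (m + 2) 0 f') (K - 2) ?_ ?_ ?_).mono
    (loopTime_mono (Nat.sub_le _ _) le_rfl) ?_
  · rintro m hm _ ⟨j', l', i', u', q', f', rfl, hf'⟩
    have hmk : (m + 2 + 1) * M ≤ K * M := Nat.mul_le_mul_right _ (by omega)
    refine ⟨?_, Ends.seq ((instrProg_ends (by omega) hL (by omega) (by omega) hv hf').mono le_rfl
      ?_)⟩
    · rw [Nat.succ_mul] at hmk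
      simp [NExp.eval, registers_apply]
      omega
    rintro _ ⟨j'', l'', i'', u'', q'', f'', rfl, hf''⟩
    refine Ends.setN ⟨j'', l'', i'', u'', q'', f'', ?_, hf''.next hmk⟩
    simp [NExp.eval, update_registers, registers_apply, Nat.succ_mul, add_right_comm]
  · rintro _ ⟨j', l', i', u', q', f', rfl, -⟩
    simp [NExp.eval, registers_apply, Nat.sub_add_cancel hK]
  -- The results `1` and `X` need no parameters: `paramOffset 2 = 0`, so no digit of `v` has been
  -- used yet.
  · refine ⟨j, l, K * M, u, q, _, ?_, Tracks.init _ hM (Nat.mul_le_mul_right _ hK) f⟩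
    simp [NExp.eval, FExp.eval, update_registers, registers_apply, paramOffset, two_mul]
  · rintro _ ⟨j', l', i', u', q', f', rfl, hf'⟩
    rw [Nat.sub_add_cancel hK] at hf'
    exact ⟨_, _, _, _, _, _, _, _, rfl, hf'⟩

/-! ### Printing -/

/-- Add the digits of cell `12` in base `B`. -/
def digitSumProg : Prog :=
  .seq (.setN (.lit 10) (.lit 0)) <|
  .seq (.setN (.lit 8) (cell 12)) <|
  .seq (.setN (.lit 11) (cell 0)) <|
  .while (cell 11) <|
  .seq (divProg 8 1 14) <|
  .seq (.setN (.lit 10) (.add (cell 10) (cell 8))) <|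
  .seq (.setN (.lit 8) (cell 14))
    (.setN (.lit 11) (.sub (cell 11) (.lit 1)))

/-- The time for `digitSumProg`. -/
def digitSumTime (n M : ℕ) : ℕ :=
  1 + (1 + (1 + loopTime n (1 + loopTime M 2 + (1 + (1 + 1)))))

theorem digitSumProg_ends (hB : 0 < B) (hi : i ≤ M) :
    Ends e digitSumProg ⟨regs n B M K L V Z v w p j l i u q, f, o⟩ (digitSumTime n M)
      (fun S => ∃ w' l' q', S = ⟨regs n B M K L V Z v w' p
          (∑ x ∈ Finset.range n, i / B ^ x % B) l' i u q', f, o⟩) := by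
  refine Ends.seq (Ends.setN (Ends.seq (Ends.setN (Ends.seq (Ends.setN ?_)))))
  refine (Ends.while (fun m S => ∃ q', S = ⟨regs n B M K L V Z v (i / B ^ m) p
    (∑ x ∈ Finset.range m, i / B ^ x % B) (n - m) i u q', f, o⟩) n ?_ ?_ ?_).mono le_rfl ?_
  · rintro m hm _ ⟨q', rfl⟩
    refine ⟨?_, Ends.seq ((divProg_ends (by decide) (by decide) (by decide) _ hB (t := M)
      ((Nat.div_le_self _ _).trans hi)).mono le_rfl ?_)⟩
    · simp [NExp.eval, registers_apply]
      omega
    rintro _ rfl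
    refine Ends.seq (Ends.setN (Ends.seq (Ends.setN (Ends.setN ⟨i / B ^ m / B, ?_⟩))))
    simp [NExp.eval, update_registers, registers_apply, Finset.sum_range_succ,
      Nat.div_div_eq_div_mul, pow_succ, Nat.sub_sub]
  · rintro _ ⟨q', rfl⟩
    simp [NExp.eval, registers_apply]
  · exact ⟨q, by simp [NExp.eval, update_registers, registers_apply]⟩
  · rintro _ ⟨q', rfl⟩
    exact ⟨_, _, _, rfl⟩

/-- Print the coefficients with the Kronecker codes of the last result of the universal program. -/
def printProg : Prog :=
  .seq (.setN (.lit 12) (.lit 0)) <|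
  .while (.sub (cell 2) (cell 12)) <|
  .seq digitSumProg <|
  .seq (.ite (.sub (.add (cell 0) (.lit 1)) (cell 10))
    (.print (.mem (.add (.sub (cell 6) (cell 2)) (cell 12)))) .skip)
    (.setN (.lit 12) (.add (cell 12) (.lit 1)))

/-- The time for `printProg`. -/
def printTime (n M : ℕ) : ℕ := 1 + loopTime M (digitSumTime n M + (1 + 1 + 1))

theorem printProg_ends (hM : M = 2 ^ (n * n)) :
    Ends e printProg ⟨regs n (2 ^ n) M K L V Z v w p j l i u q, f, o⟩ (printTime n M)
      (fun S => ∃ w' j' l' i' q', S = ⟨regs n (2 ^ n) M K L V Z v w' p j' l' i' u q', f,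
        o ++ (kroneckerCodes n).map fun i => f (Z - M + i)⟩) := by
  refine Ends.seq (Ends.setN ?_)
  refine (Ends.while (fun m S => ∃ w' j' l' q',
    S = ⟨regs n (2 ^ n) M K L V Z v w' p j' l' m u q', f,
      o ++ ((List.range m).filter fun i =>
        (∑ x ∈ Finset.range n, i / (2 ^ n) ^ x % 2 ^ n) ≤ n).map fun i => f (Z - M + i)⟩)
    M ?_ ?_ ?_).mono le_rfl ?_
  · rintro m hm _ ⟨w', j', l', q', rfl⟩
    refine ⟨?_, Ends.seq ((digitSumProg_ends (by positivity) hm.le).mono le_rfl ?_)⟩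
    · simp [NExp.eval, registers_apply]
      omega
    rintro _ ⟨w'', l'', q'', rfl⟩
    -- The test `n + 1 - digit sum` is non-zero exactly for the codes of monomials of degree at most
    -- `n`.
    refine Ends.seq (Ends.ite (fun hc => Ends.print ?_) (fun hc => Ends.skip ?_))
    · refine Ends.setN ⟨w'', ∑ x ∈ Finset.range n, m / (2 ^ n) ^ x % 2 ^ n, l'', q'', ?_⟩
      have hc' : (∑ x ∈ Finset.range n, m / (2 ^ n) ^ x % 2 ^ n) ≤ n := by
        simp [NExp.eval, registers_apply] at hc
        omega
      simp [NExp.eval, FExp.eval, update_registers, registers_apply, List.range_succ, hc']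
    · refine Ends.setN ⟨w'', ∑ x ∈ Finset.range n, m / (2 ^ n) ^ x % 2 ^ n, l'', q'', ?_⟩
      have hc' : ¬ (∑ x ∈ Finset.range n, m / (2 ^ n) ^ x % 2 ^ n) ≤ n := by
        simp [NExp.eval, registers_apply] at hc
        omega
      simp [NExp.eval, update_registers, registers_apply, List.range_succ, hc']
  · rintro _ ⟨w', j', l', q', rfl⟩
    simp [NExp.eval, registers_apply]
  · exact ⟨w, j, l, q, by simp [NExp.eval, update_registers]⟩
  · rintro _ ⟨w', j', l', q', rfl⟩
    exact ⟨_, _, _, _, _, by rw [kroneckerCodes, hM]⟩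

end Universal

/-! ### The complete program -/

section Main

variable {F : Type*} [Field F] {e : ℕ → F}
  {n B M K L V Z v w p j l i u q : ℕ} {f : ℕ → F} {o : List F}

/-- Put the power with exponent `a` of cell `8` into cell `3`. -/
def powProg : ℕ → Prog
  | 0 => .setN (.lit 3) (.lit 1)
  | a + 1 => .seq (powProg a) <| .seq (mulProg 9 3 8 14) (.setN (.lit 3) (cell 9))

/-- The time for a multiplication. -/
def mulTime (t : ℕ) : ℕ := 1 + (1 + loopTime t 2)

/-- The time for `powProg`. -/
def powTime (t : ℕ) : ℕ → ℕ
  | 0 => 1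
  | a + 1 => powTime t a + (mulTime t + 1)

/-- The exponent is a constant of the program, so the multiplications are unrolled. Each one loops
as often as the power reached so far. -/
theorem powProg_ends (a : ℕ) {t : ℕ} (ht : ∀ m < a, w ^ m ≤ t) :
    Ends e (powProg a) ⟨regs n B M K L V Z v w p j l i u q, f, o⟩ (powTime t a)
      (fun S => ∃ p' q', S = ⟨regs n B M (w ^ a) L V Z v w p' j l i u q', f, o⟩) := by
  induction a with
  | zero => exact Ends.setN ⟨p, q, by simp [NExp.eval, update_registers]⟩
  | succ a ih =>
    refine Ends.seq ((ih fun m hm => ht m (by omega)).mono le_rfl ?_)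
    rintro _ ⟨p', q', rfl⟩
    refine Ends.seq ((mulProg_ends (by decide) (by decide) (by decide) (by decide) _
      (ht a a.lt_succ_self)).mono le_rfl ?_)
    rintro _ rfl
    refine Ends.setN ⟨w ^ a * w, 0, ?_⟩
    simp [NExp.eval, update_registers, registers_apply, pow_succ]

/-- Compute the sizes, with `K = (n + a) ^ a`. -/
def setupProg (a : ℕ) : Prog :=
  .seq (twoPowProg 1 0 14) <|
  .seq (mulProg 8 0 0 14) <|
  .seq (twoPowProg 2 8 14) <|
  .seq (.setN (.lit 8) (.add (cell 0) (.lit a))) <|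
  .seq (powProg a) <|
  .seq (.setN (.lit 8) (.add (cell 3) (cell 3))) <|
  .seq (twoPowProg 4 8 14) <|
  .seq (mulProg 9 3 3 14) <|
  .seq (mulProg 10 9 9 14) <|
  .seq (.setN (.lit 8) (.add (cell 10) (cell 10))) <|
  .seq (twoPowProg 5 8 14) (mulProg 6 3 2 14)

/-- The time for `setupProg`. -/
def setupTime (t a : ℕ) : ℕ :=
  mulTime t + (mulTime t + (mulTime t + (1 + (powTime t a + (1 + (mulTime t + (mulTime t +
    (mulTime t + (1 + (mulTime t + mulTime t))))))))))

/-- A power of two costs its exponent and a product its first factor, so every loop runs at most `2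
* K ^ 4` times; in `K * M` the counter is `K`. -/
theorem setupProg_ends {a t : ℕ} (hK : K = (n + a) ^ a) (hn : 1 ≤ n) (hnK : n * n ≤ K)
    (ht : K * K * (K * K) + K * K * (K * K) ≤ t) :
    Ends e (setupProg a) (State.init F n) (setupTime t a)
      (fun S => ∃ w p j, S = ⟨regs n (2 ^ n) (2 ^ (n * n)) K (2 ^ (K + K))
        (2 ^ (K * K * (K * K) + K * K * (K * K))) (K * 2 ^ (n * n)) 0 w p j 0 0 0 0,
        fun _ => 0, []⟩) := by
  have h1 : n ≤ n * n := Nat.le_mul_self n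
  have h2 : K ≤ K * K := Nat.le_mul_self K
  have h3 : K * K ≤ K * K * (K * K) := Nat.le_mul_self _
  have hinit : State.init F n = ⟨regs n 0 0 0 0 0 0 0 0 0 0 0 0 0 0, fun _ => 0, []⟩ := by
    rw [State.init]
    congr 1
    funext x
    rw [regs, registers_apply]
    by_cases hx : x < 15
    · interval_cases x <;> rfl
    · rw [if_neg (by omega), List.getD_eq_default _ _ (by simp; omega)]
  rw [hinit]
  refine Ends.seq ((twoPowProg_ends (by decide) (by decide) _ (t := t) ?_).mono le_rfl ?_)
  · simp [registers_apply]; omega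
  rintro _ rfl
  simp only [update_registers, List.length_cons, List.length_nil, Nat.reduceAdd, Nat.reduceLT,
      List.set_cons_succ, List.set_cons_zero, registers_apply, List.getD_cons_zero]
  refine Ends.seq ((mulProg_ends (by decide) (by decide) (by decide) (by decide) _ (t := t)
    ?_).mono le_rfl ?_)
  · simp [registers_apply]; omega
  rintro _ rfl
  simp only [update_registers, List.length_cons, List.length_nil, Nat.reduceAdd, Nat.reduceLT,
      List.set_cons_succ, List.set_cons_zero, registers_apply, List.getD_cons_zero]
  refine Ends.seq ((twoPowProg_ends (by decide) (by decide) _ (t := t) ?_).mono le_rfl ?_)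
  · simp [registers_apply]; omega
  rintro _ rfl
  refine Ends.seq (Ends.setN (Ends.seq ?_))
  simp only [NExp.eval, update_registers, List.length_cons, List.length_nil, Nat.reduceAdd,
      Nat.reduceLT, List.set_cons_succ, List.set_cons_zero, registers_apply, List.getD_cons_succ,
      List.getD_cons_zero]
  refine (powProg_ends a (t := t) ?_).mono le_rfl ?_
  · intro m hm
    have : (n + a) ^ m ≤ (n + a) ^ a := Nat.pow_le_pow_right (by omega) hm.le
    omega
  rintro _ ⟨p', q', rfl⟩
  rw [← hK]
  refine Ends.seq (Ends.setN (Ends.seq ?_))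
  simp only [NExp.eval, update_registers, List.length_cons, List.length_nil, Nat.reduceAdd,
      Nat.reduceLT, List.set_cons_succ, List.set_cons_zero, registers_apply, List.getD_cons_succ,
      List.getD_cons_zero]
  refine (twoPowProg_ends (by decide) (by decide) _ (t := t) ?_).mono le_rfl ?_
  · simp [registers_apply]; omega
  rintro _ rfl
  simp only [update_registers, List.length_cons, List.length_nil, Nat.reduceAdd, Nat.reduceLT,
      List.set_cons_succ, List.set_cons_zero, registers_apply, List.getD_cons_succ,
      List.getD_cons_zero]
  refine Ends.seq ((mulProg_ends (by decide) (by decide) (by decide) (by decide) _ (t := t)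
    ?_).mono le_rfl ?_)
  · simp [registers_apply]; omega
  rintro _ rfl
  simp only [update_registers, List.length_cons, List.length_nil, Nat.reduceAdd, Nat.reduceLT,
      List.set_cons_succ, List.set_cons_zero, registers_apply, List.getD_cons_succ,
      List.getD_cons_zero]
  refine Ends.seq ((mulProg_ends (by decide) (by decide) (by decide) (by decide) _ (t := t)
    ?_).mono le_rfl ?_)
  · simp [registers_apply]; omega
  rintro _ rfl
  refine Ends.seq (Ends.setN (Ends.seq ?_))
  simp only [NExp.eval, update_registers, List.length_cons, List.length_nil, Nat.reduceAdd,
      Nat.reduceLT, List.set_cons_succ, List.set_cons_zero, registers_apply, List.getD_cons_succ,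
      List.getD_cons_zero]
  refine (twoPowProg_ends (by decide) (by decide) _ (t := t) ?_).mono le_rfl ?_
  · simp [registers_apply]; omega
  rintro _ rfl
  simp only [update_registers, List.length_cons, List.length_nil, Nat.reduceAdd, Nat.reduceLT,
      List.set_cons_succ, List.set_cons_zero, registers_apply, List.getD_cons_succ,
      List.getD_cons_zero]
  refine (mulProg_ends (by decide) (by decide) (by decide) (by decide) _ (t := t)
    ?_).mono le_rfl ?_
  · simp [registers_apply]; omega
  rintro _ rfl
  refine ⟨K * K * (K * K) + K * K * (K * K), K * K, K * K * (K * K), ?_⟩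
  simp [update_registers, registers_apply]

/-- Print the hitting set. -/
def hittingSetProg (a : ℕ) : Prog :=
  .seq (setupProg a) <|
  .while (.sub (cell 5) (cell 7)) <|
  .seq universalProg <|
  .seq printProg (.setN (.lit 7) (.add (cell 7) (.lit 1)))

/-- The time for `hittingSetProg`. -/
def hittingSetTime (n M K V a : ℕ) : ℕ :=
  setupTime V a + loopTime V (universalTime M K V (K * M) + (printTime n M + 1))

theorem ofFn_gridPoint (e : ℕ → F) (n K L v : ℕ) :
    List.ofFn (gridPoint e n K L v) = (kroneckerCodes n).map
      fun i => (universal (fun x => e (v / L ^ x % L)) (K - 1)).coeff i := by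
  conv_rhs => rw [← List.ofFn_get (kroneckerCodes n), List.map_ofFn]
  rfl

theorem hittingSetProg_prints (e : ℕ → F) {a : ℕ} (hK : K = (n + a) ^ a) (hn : 1 ≤ n)
    (hnK : n * n ≤ K) (hK2 : 2 ≤ K) (hM : M = 2 ^ (n * n))
    (hV : V = 2 ^ (K * K * (K * K) + K * K * (K * K))) :
    PrintsWithin e (hittingSetProg a) n (hittingSetTime n M K V a)
      ((List.range V).map (gridPoint e n K (2 ^ (K + K)))) := by
  have hM2 : 2 ≤ M := by
    rw [hM]
    exact Nat.le_self_pow (Nat.mul_pos hn hn).ne' 2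
  suffices h : Ends e (hittingSetProg a) (State.init F n) (hittingSetTime n M K V a)
      (fun S => S.out = (List.range V).flatMap fun v =>
        List.ofFn (gridPoint e n K (2 ^ (K + K)) v)) by
    obtain ⟨T, hT, S, hr, hS⟩ := h
    exact ⟨T, hT, S, hr, by rw [hS, List.flatMap_map]⟩
  refine Ends.seq ((setupProg_ends hK hn hnK (t := V) (hV ▸ Nat.lt_two_pow_self.le)).mono le_rfl ?_)
  rintro _ ⟨w, p, j, rfl⟩
  rw [← hM, ← hV]
  refine (Ends.while (fun m S => ∃ w' p' j' l' i' u' q' f',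
    S = ⟨regs n (2 ^ n) M K (2 ^ (K + K)) V (K * M) m w' p' j' l' i' u' q', f',
      (List.range m).flatMap fun v => List.ofFn (gridPoint e n K (2 ^ (K + K)) v)⟩)
    V ?_ ?_ ?_).mono le_rfl ?_
  · rintro m hm _ ⟨w', p', j', l', i', u', q', f', rfl⟩
    refine ⟨?_, Ends.seq ((universalProg_ends hM2 (by positivity) hK2 hm.le).mono le_rfl ?_)⟩
    · simp [NExp.eval, registers_apply]
      omega
    rintro _ ⟨w₁, p₁, j₁, l₁, i₁, u₁, q₁, f₁, rfl, hf⟩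
    refine Ends.seq ((printProg_ends hM).mono le_rfl ?_)
    rintro _ ⟨w₂, j₂, l₂, i₂, q₂, rfl⟩
    refine Ends.setN ⟨w₂, p₁, j₂, l₂, i₂, u₁, q₂, f₁, ?_⟩
    have hprint : ((kroneckerCodes n).map fun i => f₁ (K * M - M + i))
        = List.ofFn (gridPoint e n K (2 ^ (K + K)) m) := by
      rw [ofFn_gridPoint]
      refine List.map_congr_left fun i hi => ?_
      -- The last result starts at `(K - 1) * M = Z - M`, and all codes are below `M`.
      rw [← hf.old (K - 1) (by omega) i
        (by rw [hM]; exact List.mem_range.1 (List.mem_filter.1 hi).1), Nat.sub_mul, one_mul]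
    simp [NExp.eval, update_registers, registers_apply, List.range_succ, hprint]
  · rintro _ ⟨w', p', j', l', i', u', q', f', rfl⟩
    simp [NExp.eval, registers_apply]
  · exact ⟨w, p, j, 0, 0, 0, 0, _, rfl⟩
  · rintro _ ⟨w', p', j', l', i', u', q', f', rfl⟩
    rfl

/-! ### The time bound -/

theorem loopTime_le {N τ Q k : ℕ} (hQ : 3 ≤ Q) (hN : N ≤ Q) (hτ : τ ≤ Q ^ k) :
    loopTime N τ ≤ Q ^ (k + 2) := by
  refine (loopTime_mono hN hτ).trans ?_
  have h1 : 1 ≤ Q ^ k := Nat.one_le_pow _ _ (by omega)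
  rw [loopTime, pow_add]
  nlinarith [Nat.mul_le_mul_right (Q * Q) h1, Nat.mul_le_mul hQ (le_refl (Q * Q ^ k))]

/-- With `loopTime_le`, this gives a coarse calculus of exponents: a sum adds one to the larger
exponent, a loop adds two. -/
theorem add_le_pow {x y Q k m : ℕ} (hQ : 3 ≤ Q) (hx : x ≤ Q ^ k) (hy : y ≤ Q ^ m) :
    x + y ≤ Q ^ (max k m + 1) := by
  have h1 : Q ^ k ≤ Q ^ max k m := Nat.pow_le_pow_right (by omega) (le_max_left _ _)
  have h2 : Q ^ m ≤ Q ^ max k m := Nat.pow_le_pow_right (by omega) (le_max_right _ _)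
  rw [pow_succ]
  nlinarith

theorem powTime_le {t Q k a : ℕ} (hQ : 3 ≤ Q) (ha : a ≤ Q) (ht : mulTime t ≤ Q ^ k) :
    powTime t a ≤ Q ^ (k + 3) := by
  have h : ∀ a, powTime t a = a * (mulTime t + 1) + 1 := fun a => by
    induction a with
    | zero => simp [powTime]
    | succ a ih => rw [powTime, ih]; ring
  rw [h]
  exact (loopTime_le hQ ha ht).trans (Nat.pow_le_pow_right (by omega) (by omega))

theorem hittingSetTime_le {a : ℕ} (hV : 3 ≤ V) (hn : n ≤ V) (ha : a ≤ V) (hM : M ≤ V)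
    (hK : K ≤ V) (hKM : K * M ≤ V) : hittingSetTime n M K V a ≤ V ^ 40 := by
  have h0 : 1 ≤ V ^ 0 := le_rfl
  have h2 : 2 ≤ V ^ 1 := by rw [pow_one]; omega
  have hmul : mulTime V ≤ V ^ 5 :=
    add_le_pow hV h0 (add_le_pow hV h0 (loopTime_le hV le_rfl h2))
  have hconv : convTime M ≤ V ^ 8 := add_le_pow hV h0 (loopTime_le hV hM
    (add_le_pow hV h0 (add_le_pow hV (loopTime_le hV hM h2) h0)))
  have hrow : rowTime M K V ≤ V ^ 13 := add_le_pow hV h0 (loopTime_le hV hK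
    (add_le_pow hV (add_le_pow hV h0 (loopTime_le hV le_rfl h2))
      (add_le_pow hV hconv (add_le_pow hV h0 h0))))
  have huniv : universalTime M K V (K * M) ≤ V ^ 25 :=
    add_le_pow hV (add_le_pow hV h0 (loopTime_le hV hKM h2)) (add_le_pow hV h0 (add_le_pow hV h0
      (add_le_pow hV h0 (add_le_pow hV h0 (loopTime_le hV hK (add_le_pow hV (add_le_pow hV h0
        (loopTime_le hV hK (add_le_pow hV hrow h0))) h0))))))
  have hdig : digitSumTime n M ≤ V ^ 10 :=
    add_le_pow hV h0 (add_le_pow hV h0 (add_le_pow hV h0 (loopTime_le hV hn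
      (add_le_pow hV (add_le_pow hV h0 (loopTime_le hV hM h2))
        (add_le_pow hV h0 (add_le_pow hV h0 h0))))))
  have hprint : printTime n M ≤ V ^ 14 := add_le_pow hV h0 (loopTime_le hV hM
    (add_le_pow hV hdig (add_le_pow hV (add_le_pow hV h0 h0) h0)))
  have hpow : powTime V a ≤ V ^ 8 := powTime_le hV ha hmul
  have hset : setupTime V a ≤ V ^ 18 :=
    (add_le_pow hV hmul (add_le_pow hV hmul (add_le_pow hV hmul (add_le_pow hV h0
      (add_le_pow hV hpow (add_le_pow hV h0 (add_le_pow hV hmul (add_le_pow hV hmul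
        (add_le_pow hV hmul (add_le_pow hV h0 (add_le_pow hV hmul hmul))))))))))).trans
      (Nat.pow_le_pow_right (by omega) (by decide))
  exact (add_le_pow hV hset (loopTime_le hV le_rfl
    (add_le_pow hV huniv (add_le_pow hV hprint h0)))).trans
      (Nat.pow_le_pow_right (by omega) (by decide))

/-- Numbers `2 ^ poly(n)` are quasipolynomial in the number of monomials. -/
theorem two_pow_le_quasiPoly {a b : ℕ} (hn : 1 ≤ n) :
    2 ^ (b * (n + a) ^ a) ≤ quasiPoly (b * (a + 1) ^ a + a) ((2 * n).choose n) := by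
  set N := (2 * n).choose n with hN
  -- From `4 ^ n ≤ 2 * n * N` and `2 * n ≤ 2 ^ n`.
  have hN2 : 2 ^ n ≤ N := by
    have h1 := Nat.four_pow_le_two_mul_self_mul_centralBinom n hn
    rw [Nat.centralBinom_eq_two_mul_choose, ← hN, show 4 = 2 * 2 from rfl, mul_pow] at h1
    have h2 : 2 * n ≤ 2 ^ n := by
      obtain ⟨m, rfl⟩ := Nat.exists_eq_add_of_le' hn
      have := Nat.lt_two_pow_self (n := m)
      rw [pow_succ]
      omega
    exact Nat.le_of_mul_le_mul_left (h1.trans (Nat.mul_le_mul_right _ h2)) (by positivity)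
  have hlog : n ≤ Nat.log 2 N := Nat.le_log_of_pow_le (by norm_num) hN2
  set c := b * (a + 1) ^ a + a with hc
  have hexp : b * (n + a) ^ a ≤ c * Nat.log 2 N ^ c := by
    have h1 : n + a ≤ (a + 1) * n := by nlinarith
    calc b * (n + a) ^ a ≤ b * ((a + 1) * n) ^ a := by gcongr
      _ = b * (a + 1) ^ a * n ^ a := by rw [mul_pow]; ring
      _ ≤ c * Nat.log 2 N ^ c := by
        refine Nat.mul_le_mul (Nat.le_add_right _ _) ?_
        calc n ^ a ≤ n ^ c := Nat.pow_le_pow_right hn (Nat.le_add_left _ _)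
          _ ≤ Nat.log 2 N ^ c := Nat.pow_le_pow_left hlog _
  have hN1 : 2 ≤ N := (Nat.le_self_pow (by omega) 2).trans hN2
  calc 2 ^ (b * (n + a) ^ a) ≤ 2 ^ (c * Nat.log 2 N ^ c) := Nat.pow_le_pow_right (by norm_num) hexp
    _ ≤ N ^ (c * Nat.log 2 N ^ c) := Nat.pow_le_pow_left hN1 _

/-- The program length `(n + a) ^ a` suffices. -/
theorem le_length_of_polyBounded {a k₁ k₂ t d : ℕ} (ha : a = k₁ + k₂ + 10)
    (hK : K = (n + a) ^ a) (ht : t ≤ n ^ k₁ + k₁) (hd : d ≤ (2 * n).choose n ^ k₂ + k₂) :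
    n * n + t + 3 ≤ K ∧ d < 2 ^ K := by
  set x := n + a with hx
  have hx10 : 10 ≤ x := by omega
  have hmono : ∀ {b c : ℕ}, b ≤ c → x ^ b ≤ x ^ c := fun h => Nat.pow_le_pow_right (by omega) h
  -- One spare factor `x ≥ 10` leaves room for all the summands below, each bounded in terms of `x ^
  -- (k₁ + 2)`.
  have hKY : 10 * x ^ (k₁ + 2) ≤ K := by
    calc 10 * x ^ (k₁ + 2) ≤ x * x ^ (k₁ + 2) := by gcongr
      _ = x ^ (k₁ + 2 + 1) := by ring
      _ ≤ x ^ a := hmono (by omega)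
      _ = K := hK.symm
  have h2 : x * x ≤ x ^ (k₁ + 2) := by rw [← sq]; exact hmono (by omega)
  have h3 : x ≤ x ^ (k₁ + 2) := Nat.le_self_pow (by omega) x
  constructor
  · have h1 : n ^ k₁ ≤ x ^ (k₁ + 2) := (Nat.pow_le_pow_left (by omega) _).trans (hmono (by omega))
    have h4 : n * n ≤ x * x := Nat.mul_le_mul (by omega) (by omega)
    omega
  · have hN : (2 * n).choose n ≤ 2 ^ (2 * n) := Nat.choose_le_two_pow _ _
    have h5 : 2 * n * k₂ ≤ 2 * (x * x) := by
      rw [mul_assoc]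
      exact Nat.mul_le_mul_left _ (Nat.mul_le_mul (by omega) (by omega))
    calc d ≤ (2 ^ (2 * n)) ^ k₂ + k₂ := hd.trans (by gcongr)
      _ < 2 ^ (2 * n * k₂ + k₂) + 2 ^ (2 * n * k₂ + k₂) := by
        refine Nat.add_lt_add_of_le_of_lt ?_ ?_
        · rw [← pow_mul]
          exact Nat.pow_le_pow_right (by norm_num) (by omega)
        · exact Nat.lt_two_pow_self.trans_le (Nat.pow_le_pow_right (by norm_num) (by omega))
      _ = 2 ^ (2 * n * k₂ + k₂ + 1) := by rw [pow_succ, mul_two]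
      _ ≤ 2 ^ K := Nat.pow_le_pow_right (by norm_num) (by omega)

end Main

end AlgComp

/-! ### Assembling the hitting set, its program and the bounds -/

theorem mainTheorem4 (s d t : ℕ → ℕ) (hs : PolyBounded s) (hd : PolyBounded d)
    (ht : PolyBounded t) :
    ∃ (P : Prog) (c : ℕ), ∀ (F : Type*) [Field F] (e : ℕ → F), IsEnumeration e →
      ∀ (n N : ℕ), 1 ≤ n → N = (2 * n).choose n → ∀ φ : Monomials n n ≃ Fin N,
        HasSuccinctHittingSet φ (t n) (circuitClass F (Fin N) (s N) (d N)) →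
        ∃ H : List (Fin N → F),
          H.length ≤ quasiPoly c N ∧
          PrintsWithin e P n (quasiPoly c N) H ∧
          IsHittingSet {α | α ∈ H} (circuitClass F (Fin N) (s N) (d N)) := by
  obtain ⟨k₁, ht⟩ := ht
  obtain ⟨k₂, hd⟩ := hd
  obtain ⟨a, ha⟩ : ∃ a, a = k₁ + k₂ + 10 := ⟨_, rfl⟩
  -- The time is at most `V ^ 40 = 2 ^ (80 * (n + a) ^ (4 * a))`; the constant is the one of
  -- `two_pow_le_quasiPoly` for `b = 80` and `4 * a` in place of `a`.
  refine ⟨hittingSetProg a, 80 * (4 * a + 1) ^ (4 * a) + 4 * a, ?_⟩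
  intro F _ e he n N hn hN φ h
  -- Both numbers count the monomials.
  obtain rfl : N = (kroneckerCodes n).length := by
    simpa using Fintype.card_congr (φ.symm.trans (kroneckerNumbering n))
  obtain ⟨K, hK⟩ : ∃ K, K = (n + a) ^ a := ⟨_, rfl⟩
  obtain ⟨hnK, hdK⟩ := le_length_of_polyBounded ha hK (ht n)
    (d := d (kroneckerCodes n).length) (hN ▸ hd (kroneckerCodes n).length)
  obtain ⟨M, hM⟩ : ∃ M, M = 2 ^ (n * n) := ⟨_, rfl⟩
  obtain ⟨E, hE⟩ : ∃ E, E = K * K * (K * K) := ⟨_, rfl⟩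
  obtain ⟨V, hV⟩ : ∃ V, V = 2 ^ (E + E) := ⟨_, rfl⟩
  have hKE : K ≤ E := hE ▸ (Nat.le_mul_self K).trans (Nat.le_mul_self _)
  have hEV : E + E < V := hV ▸ Nat.lt_two_pow_self
  have haK : n + a ≤ K := hK ▸ Nat.le_self_pow (by omega) _
  have hKM : K * M ≤ V := by
    rw [hV, hM, pow_add]
    exact Nat.mul_le_mul (hKE.trans Nat.lt_two_pow_self.le)
      (Nat.pow_le_pow_right (by norm_num) (by omega))
  have hMV : M ≤ V := (Nat.le_mul_of_pos_left M (by omega)).trans hKM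
  have hquasi : V ^ 40 ≤ quasiPoly (80 * (4 * a + 1) ^ (4 * a) + 4 * a)
      (kroneckerCodes n).length := by
    rw [hN]
    refine le_trans ?_ (two_pow_le_quasiPoly hn)
    rw [hV, ← pow_mul]
    refine Nat.pow_le_pow_right (by norm_num) ?_
    calc (E + E) * 40 = 80 * (n + a) ^ (4 * a) := by rw [hE, hK, mul_comm 4 a, pow_mul]; ring
      _ ≤ 80 * (n + 4 * a) ^ (4 * a) := by gcongr; omega
  have hVq := (Nat.le_self_pow (by norm_num : (40 : ℕ) ≠ 0) V).trans hquasi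
  refine ⟨(List.range V).map (gridPoint e n K (2 ^ (K + K))), ?_, ?_, ?_⟩
  · rw [List.length_map, List.length_range]
    exact hVq
  · obtain ⟨T, hT, S, hr, hS⟩ := hittingSetProg_prints e hK hn (by omega) (by omega) hM
      (V := V) (by rw [hV, hE])
    refine ⟨T, (hT.trans (hittingSetTime_le ?_ ?_ ?_ hMV ?_ hKM)).trans hquasi, S, hr, hS⟩ <;> omega
  · have hhit := gridPoint_hits he (V := V) (L := 2 ^ (K + K)) h hnK
      (by rw [pow_add]; exact Nat.mul_lt_mul_of_pos_right hdK (by positivity)) ?_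
    · intro D hD hD0
      obtain ⟨_, ⟨v, hv, rfl⟩, hne⟩ := hhit D hD hD0
      exact ⟨_, List.mem_map.2 ⟨v, List.mem_range.2 hv, rfl⟩, hne⟩
    -- The grid has `2 ^ (2 * K * paramOffset K)` points, and `paramOffset K ≤ K ^ 3`.
    · rw [hV, ← pow_mul]
      refine Nat.pow_le_pow_right (by norm_num) ?_
      calc (K + K) * paramOffset K ≤ (K + K) * K ^ 3 := Nat.mul_le_mul_left _ (paramOffset_le K)
        _ = E + E := by rw [hE]; ring
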